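/- **Setting.** For an origin-symmetric convex body $K\subset\mathbb R^n$ (compact, convex, non-empty interior, $K=-K$) let $\|x\|_K=\inf\{s>0: x\in sK\}$, and let $$\rho_K(\tau)=\tfrac12\sup_{\|x\|_K=\|y\|_K=1}\bigl(\|x+\tau y\|_K+\|x-\tau y\|_K-2\bigr),\qquad 0<\tau<1,$$ be its modulus of smoothness. For $A\in\mathbb Q^{n\times n}$ put $\Lambda(A)=\{Az: z\in\mathbb Z^n\}$. For $\gamma\ge 1$, solving $\gamma$-$\mathrm{CVP}_K$ for $\Lambda(A)$ and a target $t$ means finding $v\in\Lambda(A)$ with $\|v-t\|_K\le\gamma\,\|w-t\|_K$ for all $w\in\Lambda(A)$. Let $b$ be the total binary encoding length of $A$ and $t$. A *2-CVP solver* for $\Lambda(A)$ is a deterministic procedure that, given a membership oracle for an origin-symmetric convex body $Q$ and a target $x\in\mathbb R^n$, returns a solution of $2$-$\mathrm{CVP}_Q$ for $\Lambda(A)$ and $x$; each membership query counts as one of its steps. A query $(Q,x)$ has size at most $\ell\in\mathbb N$ if the encoding length of $A$ is at most $\ell$, $2^{-\ell}B_2^n\subseteq Q\subseteq 2^{\ell}B_2^n$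 and $\|x\|_2\le 2^{\ell}$. The solver has running time $2^{O(n)}\mathrm{poly}(n,\ell)$ with constant $\kappa\in\mathbb N$ if it makes at most $2^{\kappa n}(n+\ell)^{\kappa}$ steps on every query of size at most $\ell$. Algorithms are programs for a real RAM (unit-cost $+,-,\cdot,/,\max,\exp,\log$ and comparison of reals; an operation on vectors in $\mathbb R^n$ costs $\Theta(n)$) with oracles for $\|\cdot\|_K$, for a non-zero normal vector of a supporting hyperplane of $K$ at a given boundary point, and for independent uniform samples from $K$, each at cost $n+1$. They access the lattice through a 2-CVP solver only. A program may call the solver on a body whose membership oracle is given by a loop-free piece of its own code. The call is charged the steps of the solver times the cost of one evaluation of that code (up to an additive overhead linear in $n$ in each factor), plus the cost of computing and copying the target. The space of a run is the number of memory cells of the program plus the largest number of cells used by the solver in a call. **Theorem (Boosting 2-CVP for a body with small modulus of smoothness).** There are a single program and a constant $a$, and for every $\kappa$ a constant $B$, such that the following holds for all $n\ge1$, all origin-symmetric convex bodies $K$ with $n^{-3/2}B_2^n\subseteq K\subseteq B_2^n$, all real $C,q>1$ with $\rho_K(\tau)\le C\tau^q$ for all $\tau\in(0,1)$, all $\epsilon\in(0,1)$,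 all $A\in\mathbb Q^{n\times n}$, $t\in\mathbb Q^n$, all supporting hyperplane oracles for $K$, and all 2-CVP solvers for $\Lambda(A)$. On input $n,\epsilon,C,q,t$: 1. (Correctness.) With probability at least $1-2^{-n}$ the program outputs a solution of $(1+\epsilon)$-$\mathrm{CVP}_K$ for $\Lambda(A)$ and $t$. (If the success event is not measurable, this means that the failure event has outer measure at most $2^{-n}$.) 2. (Time.) If the solver has running time $2^{O(n)}\mathrm{poly}(n,\ell)$ with constant $\kappa$, then for every outcome of the samples in $K$ the program halts after at most $$B\,(n+b+\log(1/\epsilon))^{B}\Bigl(2^{Bn}C^{n/q}(1/\epsilon)^{n/q}+(BC)^{n/(q-1)}\Bigr)$$ steps, the steps of the solver included. 3. (Space.) For every outcome of the samples in $K$ the program halts (whatever the running time of the solver), and it uses at most $\sigma+a\,n$ memory cells whenever $\sigma$ bounds the space of the solver on all queries of size at most $a\,(n+b+\lceil\log(1/\epsilon)\rceil)$. -/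

import Mathlib

open MeasureTheory ProbabilityTheory

noncomputable section

namespace BoostCVP

/-- Euclidean space `ℝⁿ`. -/
abbrev E (n : ℕ) : Type := EuclideanSpace ℝ (Fin n)

/-! ### Bodies, modulus of smoothness, lattices -/

/-- Origin-symmetric convex bodies: compact convex sets with non-empty interior and `K = -K`. -/
structure IsSymmConvexBody {n : ℕ} (K : Set (E n)) : Prop where
  convex : Convex ℝ K
  isCompact : IsCompact K
  interior_nonempty : (interior K).Nonempty
  neg_mem : ∀ x ∈ K, -x ∈ K

/-- The modulus of smoothness
`ρ_K(τ) = 1/2 * sup_{‖x‖_K = ‖y‖_K = 1} (‖x + τ y‖_K + ‖x - τ y‖_K - 2)`;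
here `gauge K x = inf {s > 0 | x ∈ s K}` is `‖x‖_K`. -/
def modulusOfSmoothness {n : ℕ} (K : Set (E n)) (τ : ℝ) : ℝ :=
  (1 / 2) * sSup {r : ℝ | ∃ x y : E n, gauge K x = 1 ∧ gauge K y = 1 ∧
    r = gauge K (x + τ • y) + gauge K (x - τ • y) - 2}

/-- The rational lattice `Λ(A) = {A z | z ∈ ℤⁿ}`, as a subset of `ℝⁿ`. -/
def lattice {n : ℕ} (A : Matrix (Fin n) (Fin n) ℚ) : Set (E n) :=
  {v | ∃ z : Fin n → ℤ, ∀ i, v i = ∑ j, (A i j : ℝ) * (z j : ℝ)}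

/-- The real vector with the given rational coordinates. -/
def ratVec {n : ℕ} (t : Fin n → ℚ) : E n := WithLp.toLp 2 (fun i => (t i : ℝ))

/-- `v` is a `γ`-approximate closest lattice vector of `Λ(A)` to `x` for the norm `‖·‖_Q`. -/
def IsApproxClosest {n : ℕ} (γ : ℝ) (Q : Set (E n)) (A : Matrix (Fin n) (Fin n) ℚ)
    (x v : E n) : Prop :=
  v ∈ lattice A ∧ ∀ w ∈ lattice A, gauge Q (v - x) ≤ γ * gauge Q (w - x)

/-- `ν p` is a normal vector of a hyperplane supporting `K` at `p`, for every boundary point `p`: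
`ν p ≠ 0` and `⟨ν p, x⟩ ≤ ⟨ν p, p⟩` on `K`. -/
def IsSupportOracle {n : ℕ} (K : Set (E n)) (ν : E n → E n) : Prop :=
  ∀ p, gauge K p = 1 → ν p ≠ 0 ∧ ∀ x ∈ K, inner ℝ (ν p) x ≤ inner ℝ (ν p) p

/-! ### Encoding lengths -/

/-- Binary encoding length of a rational number: sign, numerator and denominator. -/
def ratLength (r : ℚ) : ℕ := 1 + Nat.size r.num.natAbs + Nat.size r.den

/-- Encoding length of the input `A`, `t`. -/
def encLength {n : ℕ} (A : Matrix (Fin n) (Fin n) ℚ) (t : Fin n → ℚ) : ℕ :=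
  (∑ i, ∑ j, ratLength (A i j)) + ∑ i, ratLength (t i)

/-- A CVP instance `(A, Q, x)` has size at most `ℓ`: the encoding length of `A` is at most `ℓ`, the
body is sandwiched between Euclidean balls of radii `2^(-ℓ)` and `2^ℓ`, and the target has length
at most `2^ℓ`. -/
def InstanceSizeLE {n : ℕ} (A : Matrix (Fin n) (Fin n) ℚ) (Q : Set (E n)) (x : E n) (ℓ : ℕ) :
    Prop :=
  (∑ i, ∑ j, ratLength (A i j)) ≤ ℓ ∧
  Metric.closedBall 0 ((2 : ℝ) ^ ℓ)⁻¹ ⊆ Q ∧ Q ⊆ Metric.closedBall 0 ((2 : ℝ) ^ ℓ) ∧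
  ‖x‖ ≤ (2 : ℝ) ^ ℓ

/-! ### 2-approximate CVP solvers -/

/-- The behaviour on the lattice `Λ(A)` of a deterministic 2-approximate CVP solver that handles
every norm. The norm `‖·‖_Q` is given to it by a membership oracle for its unit ball `Q`.
`time Q x` is the number of its steps, a membership query counting as one step; `space Q x` is the
number of its memory cells. -/
structure TwoCVPSolver {n : ℕ} (A : Matrix (Fin n) (Fin n) ℚ) where
  answer : Set (E n) → E n → E n
  time : Set (E n) → E n → ℕ
  space : Set (E n) → E n → ℕ
  correct : ∀ Q, IsSymmConvexBody Q → ∀ x, IsApproxClosest 2 Q A x (answer Q x)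

/-- The solver has running time `2^O(n) * poly(n, size)`, with constants bounded by `κ`. -/
def TwoCVPSolver.RunsIn {n : ℕ} {A : Matrix (Fin n) (Fin n) ℚ} (S : TwoCVPSolver A) (κ : ℕ) :
    Prop :=
  ∀ (ℓ : ℕ) (Q : Set (E n)) (x : E n), IsSymmConvexBody Q → InstanceSizeLE A Q x ℓ →
    S.time Q x ≤ 2 ^ (κ * n) * (n + ℓ) ^ κ

/-! ### The machine model

A real RAM (unit cost for `+`, `-`, `*`, `/`, `max`, `exp`, `log` and comparison of real numbers).
A program is a single finite text that does not depend on the dimension `n`; it has finitely many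
scalar registers and finitely many vector registers, a vector register consisting of `n` cells.
Every operation that touches a vector costs at least `n`. The body `K` is accessed through an oracle
for its norm, an oracle for supporting hyperplanes at boundary points, and an oracle for uniform
samples. The lattice is accessed through the 2-approximate CVP solver only. -/

/-- The two types of registers. -/
inductive Ty
  | sc
  | vec

/-- Values of each type. -/
abbrev Ty.Val (n : ℕ) : Ty → Type
  | .sc => ℝ
  | .vec => E n

/-- Loop-free terms. -/
inductive Expr : Ty → Type
  | svar (i : ℕ) : Expr .sc
  | const (c : ℚ) : Expr .sc
  | add (a b : Expr .sc) : Expr .sc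
  | sub (a b : Expr .sc) : Expr .sc
  | mul (a b : Expr .sc) : Expr .sc
  | div (a b : Expr .sc) : Expr .sc
  | max (a b : Expr .sc) : Expr .sc
  | exp (a : Expr .sc) : Expr .sc
  | log (a : Expr .sc) : Expr .sc
  | dot (u v : Expr .vec) : Expr .sc
  | norm (u : Expr .vec) : Expr .sc
  | vvar (i : ℕ) : Expr .vec
  | vadd (u v : Expr .vec) : Expr .vec
  | smul (a : Expr .sc) (u : Expr .vec) : Expr .vec
  | normal (u : Expr .vec) : Expr .vec

/-- Memory contents, together with the number of samples consumed so far. -/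
structure State (n : ℕ) where
  sc : ℕ → ℝ
  vec : ℕ → E n
  pos : ℕ

/-- Overwrite a scalar register. -/
def State.setSc {n : ℕ} (s : State n) (i : ℕ) (a : ℝ) : State n :=
  { s with sc := Function.update s.sc i a }

/-- Overwrite a vector register. -/
def State.setVec {n : ℕ} (s : State n) (i : ℕ) (u : E n) : State n :=
  { s with vec := Function.update s.vec i u }

/-- Value of a term; `K` answers the norm queries, `ν` the supporting hyperplane queries. -/
def Expr.eval {n : ℕ} (K : Set (E n)) (ν : E n → E n) (s : State n) :
    {σ : Ty} → Expr σ → σ.Val n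
  | _, .svar i => s.sc i
  | _, .const c => ((c : ℚ) : ℝ)
  | _, .add a b => ((a.eval K ν s : ℝ) + (b.eval K ν s : ℝ) : ℝ)
  | _, .sub a b => ((a.eval K ν s : ℝ) - (b.eval K ν s : ℝ) : ℝ)
  | _, .mul a b => ((a.eval K ν s : ℝ) * (b.eval K ν s : ℝ) : ℝ)
  | _, .div a b => ((a.eval K ν s : ℝ) / (b.eval K ν s : ℝ) : ℝ)
  | _, .max a b => (Max.max (a.eval K ν s : ℝ) (b.eval K ν s : ℝ) : ℝ)
  | _, .exp a => Real.exp (a.eval K ν s)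
  | _, .log a => Real.log (a.eval K ν s)
  | _, .dot u v => (inner ℝ (u.eval K ν s : E n) (v.eval K ν s : E n) : ℝ)
  | _, .norm u => gauge K (u.eval K ν s : E n)
  | _, .vvar i => s.vec i
  | _, .vadd u v => ((u.eval K ν s : E n) + (v.eval K ν s : E n) : E n)
  | _, .smul a u => ((a.eval K ν s : ℝ) • (u.eval K ν s : E n) : E n)
  | _, .normal u => ν (u.eval K ν s)

/-- Number of steps for evaluating a term in dimension `n`. -/
def Expr.cost (n : ℕ) : {σ : Ty} → Expr σ → ℕ
  | _, .svar _ => 1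
  | _, .const _ => 1
  | _, .add a b => a.cost n + b.cost n + 1
  | _, .sub a b => a.cost n + b.cost n + 1
  | _, .mul a b => a.cost n + b.cost n + 1
  | _, .div a b => a.cost n + b.cost n + 1
  | _, .max a b => a.cost n + b.cost n + 1
  | _, .exp a => a.cost n + 1
  | _, .log a => a.cost n + 1
  | _, .dot u v => u.cost n + v.cost n + (2 * n + 1)
  | _, .norm u => u.cost n + (n + 1)
  | _, .vvar _ => n + 1
  | _, .vadd u v => u.cost n + v.cost n + (n + 1)
  | _, .smul a u => a.cost n + u.cost n + (n + 1)
  | _, .normal u => u.cost n + (n + 1)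

/-- Number of memory cells for a term in dimension `n`: one block of cells for every node, so that
both the registers that occur and all intermediate results are counted. -/
def Expr.cells (n : ℕ) : {σ : Ty} → Expr σ → ℕ
  | _, .svar _ => 1
  | _, .const _ => 1
  | _, .add a b => a.cells n + b.cells n + 1
  | _, .sub a b => a.cells n + b.cells n + 1
  | _, .mul a b => a.cells n + b.cells n + 1
  | _, .div a b => a.cells n + b.cells n + 1
  | _, .max a b => a.cells n + b.cells n + 1
  | _, .exp a => a.cells n + 1
  | _, .log a => a.cells n + 1
  | _, .dot u v => u.cells n + v.cells n + 1
  | _, .norm u => u.cells n + 1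
  | _, .vvar _ => n
  | _, .vadd u v => u.cells n + v.cells n + n
  | _, .smul a u => a.cells n + u.cells n + n
  | _, .normal u => u.cells n + n

/-- Programs. `solve dst tgt slot e` calls the 2-approximate CVP solver with target `tgt` and with
the body of all `x` for which `e ≤ 1` when `x` is put into the vector register `slot`: the term `e`
is the code that answers the solver's membership queries. The answer is written to `dst`. -/
inductive Prog
  | skip
  | assign (i : ℕ) (a : Expr .sc)
  | vassign (i : ℕ) (u : Expr .vec)
  | sample (i : ℕ)
  | solve (dst : ℕ) (tgt : Expr .vec) (slot : ℕ) (e : Expr .sc)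
  | seq (p q : Prog)
  | ite (a b : Expr .sc) (p q : Prog)
  | loop (a b : Expr .sc) (p : Prog)

/-- Number of memory cells that a program needs in dimension `n` besides those of the solver. -/
def Prog.cells (n : ℕ) : Prog → ℕ
  | .skip => 0
  | .assign _ a => 1 + a.cells n
  | .vassign _ u => n + u.cells n
  | .sample _ => n
  | .solve _ tgt _ e => 2 * n + tgt.cells n + e.cells n
  | .seq p q => p.cells n + q.cells n
  | .ite a b p q => a.cells n + b.cells n + p.cells n + q.cells n
  | .loop a b p => a.cells n + b.cells n + p.cells n

/-- The unit ball described by the term `e` in the state `s`. -/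
def bodyOf {n : ℕ} (K : Set (E n)) (ν : E n → E n) (s : State n) (slot : ℕ) (e : Expr .sc) :
    Set (E n) :=
  {x | (e.eval K ν (s.setVec slot x) : ℝ) ≤ 1}

/-- `Exec K ν S ω p s s' T M`: with random tape `ω` (the sequence of samples), program `p`,
started in state `s`, halts in state `s'` after `T` steps, and no call of the solver during this run
uses more than `M` cells. A call of the solver costs all steps of the solver, each of which
may be a membership query that is answered by evaluating `e`. `ite a b p q` runs `p` if `a < b` and
`q` otherwise; `loop a b p` repeats `p` while `a < b`. -/
inductive Exec {n : ℕ} {A : Matrix (Fin n) (Fin n) ℚ} (K : Set (E n)) (ν : E n → E n)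
    (S : TwoCVPSolver A) (ω : ℕ → E n) : Prog → State n → State n → ℕ → ℕ → Prop
  | skip (s) : Exec K ν S ω .skip s s 1 0
  | assign (s i a) :
      Exec K ν S ω (.assign i a) s (s.setSc i (a.eval K ν s)) (a.cost n + 1) 0
  | vassign (s i u) :
      Exec K ν S ω (.vassign i u) s (s.setVec i (u.eval K ν s)) (u.cost n + n + 1) 0
  | sample (s i) :
      Exec K ν S ω (.sample i) s { s.setVec i (ω s.pos) with pos := s.pos + 1 } (n + 1) 0
  | solve (s dst tgt slot e) :
      Exec K ν S ω (.solve dst tgt slot e) s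
        (s.setVec dst (S.answer (bodyOf K ν s slot e) (tgt.eval K ν s)))
        (tgt.cost n + n + 1 +
          S.time (bodyOf K ν s slot e) (tgt.eval K ν s) * (e.cost n + n + 1))
        (S.space (bodyOf K ν s slot e) (tgt.eval K ν s))
  | seq {p q s₁ s₂ s₃ T₁ T₂ M₁ M₂} :
      Exec K ν S ω p s₁ s₂ T₁ M₁ → Exec K ν S ω q s₂ s₃ T₂ M₂ →
      Exec K ν S ω (.seq p q) s₁ s₃ (T₁ + T₂) (max M₁ M₂)
  | ite_true {a b p q s s' T M} :
      (a.eval K ν s : ℝ) < (b.eval K ν s : ℝ) → Exec K ν S ω p s s' T M →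
      Exec K ν S ω (.ite a b p q) s s' (a.cost n + b.cost n + 1 + T) M
  | ite_false {a b p q s s' T M} :
      ¬ (a.eval K ν s : ℝ) < (b.eval K ν s : ℝ) → Exec K ν S ω q s s' T M →
      Exec K ν S ω (.ite a b p q) s s' (a.cost n + b.cost n + 1 + T) M
  | loop_true {a b p s₁ s₂ s₃ T₁ T₂ M₁ M₂} :
      (a.eval K ν s₁ : ℝ) < (b.eval K ν s₁ : ℝ) → Exec K ν S ω p s₁ s₂ T₁ M₁ →
      Exec K ν S ω (.loop a b p) s₂ s₃ T₂ M₂ →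
      Exec K ν S ω (.loop a b p) s₁ s₃ (a.cost n + b.cost n + 1 + T₁ + T₂) (max M₁ M₂)
  | loop_false {a b p s} :
      ¬ (a.eval K ν s : ℝ) < (b.eval K ν s : ℝ) →
      Exec K ν S ω (.loop a b p) s s (a.cost n + b.cost n + 1) 0

/-- The initial memory: `n`, `ε`, `C`, `q` in the scalar registers `0, 1, 2, 3`, the target `t` in the
vector register `0`, and zeros elsewhere. -/
def initState {n : ℕ} (ε C q : ℝ) (t : Fin n → ℚ) : State n where
  sc := fun i => if i = 0 then (n : ℝ) else if i = 1 then ε else if i = 2 then C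
    else if i = 3 then q else 0
  vec := fun i => if i = 0 then ratVec t else 0
  pos := 0

/-- The result of a run is read from the vector register `1`. -/
def State.output {n : ℕ} (s : State n) : E n := s.vec 1

end BoostCVP

end

open BoostCVP

/-!
The algorithm keeps the best lattice vector found so far, at distance `D` from the target, and a gap
`g = r₀ s` such that the optimum `r` satisfies `D - g ≤ r`, up to a small probability of error. A
single call of the solver for `K` itself gives `D = 2 r₀` with `r₀ ≤ r`, so that one can start with
`s = 1`. A stage shrinks `s` by the factor `3 / 4`, so `O(log (1/ε))` stages lead to `g ≤ ε r₀ ≤ ε r`.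

A stage only has to do something when the optimal vector `w` lies in the shell
`D - g ≤ ‖w - t‖ ≤ D - 3/4 g`. A trial takes a uniform sample from `K`, projects it radially to a unit
vector `p`, and calls the solver with a target in the middle of the shell in direction `p`, and with
the body cut out of a multiple of `K` by a slab parallel to the supporting hyperplane at `p`. If `p`
is within a distance of order `τ = max (s, (s/C) ^ (1/q))` from the direction of `w - t`, then
smoothness (or, for the first alternative, the triangle inequality) shows that `w` is in the body,
and that every point in the doubled body is at distance at most `D - g / 4`
(`Seminorm.le_of_two_approx`). Hence the answer of the solver improves `D` by `g / 4`. Allowing the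
first alternative keeps the size of the queries independent of `C` and `q`.

The samples for which this works contain a translate of `(τ / 32) K` that depends only on `w`, `t` and
`s` (`hitSet`). It does not depend on `D` or on the normals, which need not be chosen measurably. Its
volume is `(τ / 32) ^ n` times that of `K`, so about `(n + j) (32 / τ) ^ n` trials make stage `j` fail
with probability at most `2 ^ (-(n + 1 + j))`, and a union bound over the stages gives the success
probability (`measure_not_lucky_le`). As `32 / τ` is `O((C/ε) ^ (1/q))`, the number of trials fits
into the first term of the claimed time bound.
-/

/-! ### One improvement step in a smooth seminormed space -/

section Seminorm

variable {V : Type*} [AddCommGroup V] [Module ℝ V]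

/-- The modulus of smoothness of the seminorm `N` is at most `C * τ ^ q` on `(0, 1)`, spelled out
pointwise on the unit sphere. -/
def HasPowerSmoothness (N : Seminorm ℝ V) (C q : ℝ) : Prop :=
  ∀ τ : ℝ, 0 < τ → τ < 1 → ∀ x y : V, N x = 1 → N y = 1 →
    N (x + τ • y) + N (x - τ • y) ≤ 2 + 2 * (C * τ ^ q)

/-- The smoothness inequality for vectors of arbitrary length, by homogeneity; `b` bounds the ratio of
their lengths. -/
theorem HasPowerSmoothness.add_sub_le {N : Seminorm ℝ V} {C q : ℝ} (h : HasPowerSmoothness N C q)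
    (hC : 0 ≤ C) (hq : 0 ≤ q) {x y : V} {b : ℝ} (hx : 0 < N x) (hy : N y ≤ N x * b) (hb0 : 0 ≤ b)
    (hb : b < 1) : N (x + y) + N (x - y) ≤ 2 * N x * (1 + C * b ^ q) := by
  have hbq : 0 ≤ C * b ^ q := mul_nonneg hC (Real.rpow_nonneg hb0 q)
  rcases (apply_nonneg N y).eq_or_lt' with h0 | h0
  · have h1 := map_add_le_add N x y
    have h2 := map_sub_le_add N x y
    nlinarith
  · set ρ := N x with hρ
    set τ := N y / ρ with hτ
    have hτ0 : 0 < τ := div_pos h0 hx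
    have hτb : τ ≤ b := by rw [hτ, div_le_iff₀ hx]; linarith
    have key := h τ hτ0 (hτb.trans_lt hb) (ρ⁻¹ • x) ((N y)⁻¹ • y)
      (by rw [map_smul_eq_mul, Real.norm_of_nonneg (by positivity), ← hρ, inv_mul_cancel₀ hx.ne'])
      (by rw [map_smul_eq_mul, Real.norm_of_nonneg (by positivity), inv_mul_cancel₀ h0.ne'])
    have hs : τ • (N y)⁻¹ • y = ρ⁻¹ • y := by
      rw [smul_smul]; congr 1; rw [hτ]; field_simp
    rw [hs, ← smul_add, ← smul_sub, map_smul_eq_mul, map_smul_eq_mul,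
      Real.norm_of_nonneg (by positivity), ← mul_add, inv_mul_le_iff₀ hx] at key
    have hm : C * τ ^ q ≤ C * b ^ q :=
      mul_le_mul_of_nonneg_left (Real.rpow_le_rpow hτ0.le hτb hq) hC
    nlinarith

/-- Points close to `e / 2` are bounded away from zero, and their directions are close to `e`. -/
theorem Seminorm.sub_normalize_le (N : Seminorm ℝ V) {x e : V} {τ : ℝ} (he : N e = 1)
    (hτ : τ ≤ 1) (hx : N (x - (1 / 2 : ℝ) • e) ≤ τ / 32) :
    0 < N x ∧ N ((N x)⁻¹ • x - e) ≤ τ / 4 := by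
  have hhalf : N ((1 / 2 : ℝ) • e) = 1 / 2 := by
    rw [map_smul_eq_mul, he, Real.norm_of_nonneg (by norm_num)]; norm_num
  have habs := (abs_le.1 ((abs_sub_map_le_sub N x ((1 / 2 : ℝ) • e)).trans hx))
  rw [hhalf] at habs
  have hx4 : 1 / 4 ≤ N x := by linarith [habs.1]
  have hpos : 0 < N x := by linarith
  refine ⟨hpos, ?_⟩
  have h1 : (N x)⁻¹ • x - e = (N x)⁻¹ • ((x - (1 / 2 : ℝ) • e) + (1 / 2 - N x) • e) := by
    rw [sub_smul, sub_add_sub_cancel, smul_sub, smul_smul, inv_mul_cancel₀ hpos.ne', one_smul]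
  have h2 : N ((x - (1 / 2 : ℝ) • e) + (1 / 2 - N x) • e) ≤ τ / 16 := by
    refine (map_add_le_add N _ _).trans ?_
    rw [map_smul_eq_mul N (1 / 2 - N x), he, Real.norm_eq_abs]
    have : |1 / 2 - N x| ≤ τ / 32 := abs_le.2 ⟨by linarith [habs.2], by linarith [habs.1]⟩
    linarith
  rw [h1, map_smul_eq_mul, Real.norm_of_nonneg (by positivity), inv_mul_le_iff₀ hpos]
  have : 0 ≤ τ := by linarith [apply_nonneg N ((x - (1 / 2 : ℝ) • e) + (1 / 2 - N x) • e)]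
  nlinarith

/-- The geometric heart of the algorithm. Let `z` be a point whose norm lies in the window
`[D - g, D - 3/4 g]`, `g = r₀ s`, and let `p` be a unit vector close to the direction of `z`, with
supporting functional `f`. Around `ρ p`, `ρ = D - 7/8 g`, consider the body of all `y` with
`N y ≤ r₀ τ` and `|f y| ≤ g / 4`. It contains `z - ρ p`, by smoothness, and every `v` for which
`v - ρ p` lies in the doubled body satisfies `N v ≤ D - g / 4`, again by smoothness. The alternative
`τ = s / 4` needs only the triangle inequality; it keeps the body from becoming thin for large
`C`. -/
theorem Seminorm.le_of_two_approx (N : Seminorm ℝ V) (f : V →ₗ[ℝ] ℝ) (hf : ∀ y, f y ≤ N y)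
    {C q r₀ s D τ τ₁ : ℝ} (hsm : HasPowerSmoothness N C q) (hC : 0 ≤ C) (hq : 0 ≤ q) {z v p : V}
    (hp : N p = 1) (hfp : f p = 1) (hr₀ : 0 < r₀) (hs : 0 < s) (hs1 : s ≤ 1) (hz : r₀ ≤ N z)
    (hD : D ≤ 2 * r₀) (h1 : D - r₀ * s ≤ N z) (h2 : N z ≤ D - 3 / 4 * (r₀ * s))
    (hτ : τ = max (s / 4) τ₁) (hτ₁0 : 0 ≤ τ₁) (hτ₁ : 4 * τ₁ < 1)
    (hsmall : C * (4 * τ₁) ^ q ≤ s / 32)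
    (hclose : N (p - (N z)⁻¹ • z) ≤ τ / 4)
    (hv : ∀ T, 0 < T → N (z - (D - 7 / 8 * (r₀ * s)) • p) ≤ T →
      4 * τ / s * |f (z - (D - 7 / 8 * (r₀ * s)) • p)| ≤ T →
      N (v - (D - 7 / 8 * (r₀ * s)) • p) ≤ 2 * T ∧
      4 * τ / s * |f (v - (D - 7 / 8 * (r₀ * s)) • p)| ≤ 2 * T) :
    N v ≤ D - r₀ * s / 4 := by
  set ρ := D - 7 / 8 * (r₀ * s) with hρ
  have hg : r₀ * s ≤ r₀ := by nlinarith
  have hg0 : 0 < r₀ * s := mul_pos hr₀ hs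
  have hρ1 : 7 / 8 * r₀ ≤ ρ := by linarith
  have hρ0 : 0 < ρ := by linarith
  have hρ2 : ρ ≤ 2 * r₀ := by linarith
  have hNz : 0 < N z := by linarith
  have hsτ : s / 4 ≤ τ := hτ ▸ le_max_left _ _
  have hτ0 : 0 < τ := by linarith
  have hNx : N (ρ • p) = ρ := by rw [map_smul_eq_mul, hp, Real.norm_of_nonneg hρ0.le, mul_one]
  have hfx : f (ρ • p) = ρ := by simp [hfp]
  have hsplit : z - ρ • p = (N z - ρ) • (N z)⁻¹ • z - ρ • (p - (N z)⁻¹ • z) := by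
    rw [sub_smul (N z), smul_smul (N z), mul_inv_cancel₀ hNz.ne', one_smul, smul_sub]; abel
  have hdist : N (z - ρ • p) ≤ r₀ * τ := by
    rw [hsplit]
    refine (map_sub_le_add N _ _).trans ?_
    rw [map_smul_eq_mul, map_smul_eq_mul, map_smul_eq_mul, norm_inv, Real.norm_of_nonneg hNz.le,
      inv_mul_cancel₀ hNz.ne', Real.norm_of_nonneg hρ0.le, Real.norm_eq_abs]
    have e1 : |N z - ρ| ≤ r₀ * s / 8 := abs_le.2 ⟨by linarith, by linarith⟩
    have e2 : ρ * N (p - (N z)⁻¹ • z) ≤ 2 * r₀ * (τ / 4) :=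
      mul_le_mul hρ2 hclose (apply_nonneg _ _) (by positivity)
    nlinarith
  have hconv : ∀ T a : ℝ, 4 * τ / s * |a| ≤ T * (r₀ * τ) ↔ |a| ≤ T * (r₀ * s / 4) := by
    intro T a
    rw [div_mul_eq_mul_div, div_le_iff₀ hs]
    constructor
    · intro h
      have : 4 * τ * (|a|) ≤ 4 * τ * (T * (r₀ * s / 4)) := by nlinarith
      exact le_of_mul_le_mul_left this (by positivity)
    · intro h
      have := mul_le_mul_of_nonneg_left h (by positivity : 0 ≤ 4 * τ)
      nlinarith
  have hupper : f (z - ρ • p) ≤ r₀ * s / 4 := by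
    rw [map_sub, hfx]; linarith [hf z]
  -- If `τ = s / 4`, the slab condition is void and the triangle inequality does everything;
  -- otherwise smoothness applies to vectors of norm at most `2 r₀ τ ≤ ρ (4 τ₁)`.
  rcases le_total τ₁ (s / 4) with hc | hc
  · have hτs : τ = s / 4 := by rw [hτ, max_eq_left hc]
    have hlower : -(r₀ * s / 4) ≤ f (z - ρ • p) := by
      have := hf (-(z - ρ • p))
      rw [map_neg, map_neg_eq_map] at this
      rw [hτs] at hdist
      linarith
    have hfin := (hv (r₀ * τ) (by positivity) hdist
      (by simpa using (hconv 1 _).2 (by simpa using abs_le.2 ⟨hlower, hupper⟩))).1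
    have h3 := map_add_le_add N (v - ρ • p) (ρ • p)
    rw [sub_add_cancel, hNx] at h3
    rw [hτs] at hfin
    linarith
  · have hτs : τ = τ₁ := by rw [hτ, max_eq_right hc]
    have hb : 2 * (r₀ * τ) ≤ N (ρ • p) * (4 * τ₁) := by rw [hNx, hτs]; nlinarith
    have hsm' : 2 * ρ * (1 + C * (4 * τ₁) ^ q) ≤ 2 * ρ + r₀ * s / 8 := by nlinarith
    have smooth : ∀ y, N y ≤ 2 * (r₀ * τ) → N (ρ • p + y) + N (ρ • p - y) ≤ 2 * ρ + r₀ * s / 8 := by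
      intro y hy
      have := hsm.add_sub_le hC hq (x := ρ • p) (y := y) (by rw [hNx]; exact hρ0) (hy.trans hb)
        (by positivity) hτ₁
      rw [hNx] at this
      exact this.trans hsm'
    have hT0 : 0 ≤ r₀ * τ := by positivity
    -- A lower bound for `f (z - ρ p)` comes from the reflection of `z` in `ρ p`, whose norm is not
    -- much larger than `2 ρ - N z`.
    have hlower : -(r₀ * s / 4) ≤ f (z - ρ • p) := by
      have e1 := smooth (z - ρ • p) (by linarith)
      have e2 := hf (ρ • p - (z - ρ • p))
      rw [map_sub, hfx] at e2
      rw [add_sub_cancel] at e1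
      linarith
    obtain ⟨hfin, hfin'⟩ := hv (r₀ * τ) (by positivity) hdist
      (by simpa using (hconv 1 _).2 (by simpa using abs_le.2 ⟨hlower, hupper⟩))
    have e1 := smooth (v - ρ • p) hfin
    have e2 := hf (ρ • p - (v - ρ • p))
    have e3 := le_of_abs_le ((hconv 2 _).1 hfin')
    rw [map_sub, hfx] at e2
    rw [add_sub_cancel] at e1
    linarith

end Seminorm

namespace BoostCVP

section Bodies

open scoped Pointwise Topology

/-! ### Norms of symmetric convex bodies -/

variable {n : ℕ} {K : Set (E n)}

theorem gauge_le_norm_div {r : ℝ} (hr : 0 < r) (h : Metric.closedBall 0 r ⊆ K) (x : E n) :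
    gauge K x ≤ ‖x‖ / r := by
  rw [le_div_iff₀ hr, mul_comm]
  exact mul_gauge_le_norm (Metric.ball_subset_closedBall.trans h)

theorem gauge_smul_eq_mul {r : ℝ} (hr : 0 ≤ r) (x : E n) :
    gauge K (r • x) = r * gauge K x := by
  rw [gauge_smul_of_nonneg hr, smul_eq_mul]

namespace IsSymmConvexBody

theorem mem_nhds_zero (hK : IsSymmConvexBody K) : K ∈ 𝓝 (0 : E n) := by
  obtain ⟨x, hx⟩ := hK.interior_nonempty
  have := hK.convex.combo_interior_self_mem_interior hx (hK.neg_mem x (interior_subset hx))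
    (by norm_num : (0 : ℝ) < 1 / 2) (by norm_num : (0 : ℝ) ≤ 1 / 2) (by norm_num)
  rw [smul_neg, add_neg_cancel] at this
  exact mem_interior_iff_mem_nhds.1 this

theorem balanced (hK : IsSymmConvexBody K) : Balanced ℝ K := by
  rintro a ha _ ⟨x, hx, rfl⟩
  have h0 : (0 : E n) ∈ K := mem_of_mem_nhds hK.mem_nhds_zero
  rw [Real.norm_eq_abs] at ha
  rcases le_total 0 a with h | h
  · exact hK.convex.smul_mem_of_zero_mem h0 hx ⟨h, (le_abs_self a).trans ha⟩
  · have := hK.convex.smul_mem_of_zero_mem h0 (hK.neg_mem x hx)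
      ⟨neg_nonneg.2 h, (neg_le_abs a).trans ha⟩
    simpa using this

theorem absorbent (hK : IsSymmConvexBody K) : Absorbent ℝ K := absorbent_nhds_zero hK.mem_nhds_zero

/-- The norm `‖·‖_K`, as a seminorm. -/
noncomputable def seminorm (hK : IsSymmConvexBody K) : Seminorm ℝ (E n) :=
  gaugeSeminorm hK.balanced hK.convex hK.absorbent

theorem seminorm_apply (hK : IsSymmConvexBody K) (x : E n) : hK.seminorm x = gauge K x := rfl

theorem gauge_le_one_iff (hK : IsSymmConvexBody K) {x : E n} : gauge K x ≤ 1 ↔ x ∈ K := by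
  rw [gauge_le_one_iff_mem_closure hK.convex hK.mem_nhds_zero, hK.isCompact.isClosed.closure_eq]

theorem hasPowerSmoothness (hK : IsSymmConvexBody K) {C q : ℝ}
    (h : ∀ τ : ℝ, 0 < τ → τ < 1 → modulusOfSmoothness K τ ≤ C * τ ^ q) :
    HasPowerSmoothness hK.seminorm C q := by
  intro τ h0 h1 x y hx hy
  have hbdd : BddAbove {r : ℝ | ∃ x y : E n, gauge K x = 1 ∧ gauge K y = 1 ∧
      r = gauge K (x + τ • y) + gauge K (x - τ • y) - 2} := by
    refine ⟨2 * τ, ?_⟩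
    rintro _ ⟨x, y, hx, hy, rfl⟩
    simp only [← hK.seminorm_apply] at hx hy ⊢
    have e1 := map_add_le_add hK.seminorm x (τ • y)
    have e2 := map_sub_le_add hK.seminorm x (τ • y)
    rw [map_smul_eq_mul, hy, hx, Real.norm_of_nonneg h0.le] at e1 e2
    linarith
  have := le_csSup hbdd ⟨x, y, hx, hy, rfl⟩
  have h2 := h τ h0 h1
  unfold modulusOfSmoothness at h2
  simp only [seminorm_apply]
  linarith

theorem norm_le_gauge (hK : IsSymmConvexBody K) (h : K ⊆ Metric.closedBall 0 1) (x : E n) :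
    ‖x‖ ≤ gauge K x := by
  simpa using le_gauge_of_subset_closedBall hK.absorbent zero_le_one h (x := x)

/-- A supporting normal at a unit vector has a positive product with it. -/
theorem inner_pos_of_support (hK : IsSymmConvexBody K) {p u : E n} (hu : u ≠ 0)
    (h : ∀ x ∈ K, inner ℝ u x ≤ inner ℝ u p) : 0 < inner ℝ u p := by
  obtain ⟨r, hr, hrK⟩ := Metric.nhds_basis_closedBall.mem_iff.1 hK.mem_nhds_zero
  have hu' : 0 < ‖u‖ := norm_pos_iff.2 hu
  have := h ((r / ‖u‖) • u) (hrK (by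
    rw [mem_closedBall_zero_iff, norm_smul, Real.norm_of_nonneg (by positivity),
      div_mul_cancel₀ _ hu'.ne']))
  rw [inner_smul_right, real_inner_self_eq_norm_sq] at this
  exact lt_of_lt_of_le (by positivity) this

/-- The supporting functional, normalised to be `1` at `p`, is dominated by the norm of `K`. -/
theorem inner_div_le_gauge (hK : IsSymmConvexBody K) {p u : E n} (hu : u ≠ 0)
    (h : ∀ x ∈ K, inner ℝ u x ≤ inner ℝ u p) (y : E n) :
    inner ℝ u y / inner ℝ u p ≤ gauge K y := by
  have hpos := hK.inner_pos_of_support hu h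
  refine le_of_forall_gt fun a ha => ?_
  obtain ⟨b, hb, hba, x, hx, rfl⟩ := exists_lt_of_gauge_lt hK.absorbent ha
  refine lt_of_le_of_lt ?_ hba
  rw [div_le_iff₀ hpos]
  simp only [inner_smul_right]
  exact mul_le_mul_of_nonneg_left (h x hx) hb.le

end IsSymmConvexBody

/-- The intersection of `K` with the slab `|⟨u, y⟩| ≤ 1`. -/
def slabBody (K : Set (E n)) (u : E n) : Set (E n) := {y | gauge K y ≤ 1 ∧ |inner ℝ u y| ≤ 1}

theorem closedBall_subset_slabBody {u : E n} {c r : ℝ} (hr : 0 < r)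
    (hc : 1 ≤ c) (hrK : Metric.closedBall 0 r ⊆ K) (hu : ∀ y, |inner ℝ u y| ≤ c * gauge K y) :
    Metric.closedBall 0 (r / c) ⊆ slabBody K u := by
  intro y hy
  rw [mem_closedBall_zero_iff] at hy
  have h1 := gauge_le_norm_div hr hrK y
  have h2 : ‖y‖ / r ≤ 1 / c := by
    rw [div_le_iff₀ hr]; calc ‖y‖ ≤ r / c := hy
      _ = _ := by ring
  have h3 : 1 / c ≤ 1 := by rw [div_le_one (by linarith)]; exact hc
  refine ⟨by linarith, (hu y).trans ?_⟩
  calc c * gauge K y ≤ c * (1 / c) := mul_le_mul_of_nonneg_left (h1.trans h2) (by linarith)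
    _ = 1 := by field_simp

theorem isSymmConvexBody_slabBody (hK : IsSymmConvexBody K) (u : E n) :
    IsSymmConvexBody (slabBody K u) := by
  have hcont := continuous_gauge hK.convex hK.mem_nhds_zero
  have hsub : slabBody K u ⊆ K := fun y hy => hK.gauge_le_one_iff.1 hy.1
  have hclosed : IsClosed (slabBody K u) :=
    (isClosed_le hcont continuous_const).inter
      (isClosed_le (by fun_prop : Continuous fun y => |inner ℝ u y|) continuous_const)
  refine ⟨?_, hK.isCompact.of_isClosed_subset hclosed hsub, ⟨0, ?_⟩, ?_⟩
  · have h1 : Convex ℝ {y | |inner ℝ u y| ≤ 1} := by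
      intro x hx y hy a b ha hb hab
      simp only [Set.mem_ofPred_eq, abs_le, inner_add_right, inner_smul_right] at hx hy ⊢
      constructor <;> nlinarith [hx.1, hx.2, hy.1, hy.2]
    have h2 : Convex ℝ {y | gauge K y ≤ 1} := by
      have : {y | gauge K y ≤ 1} = K := Set.ext fun y => hK.gauge_le_one_iff
      rw [this]; exact hK.convex
    exact h2.inter h1
  · rw [mem_interior_iff_mem_nhds]
    have e1 : ∀ᶠ y in 𝓝 (0 : E n), gauge K y < 1 :=
      hcont.continuousAt.eventually_lt continuousAt_const (by simp)
    have e2 : ∀ᶠ y in 𝓝 (0 : E n), |inner ℝ u y| < 1 :=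
      (by fun_prop : Continuous fun y => |inner ℝ u y|).continuousAt.eventually_lt
        continuousAt_const (by simp)
    filter_upwards [e1, e2] with y h1 h2 using ⟨h1.le, h2.le⟩
  · rintro y ⟨h1, h2⟩
    exact ⟨by rwa [gauge_neg hK.neg_mem], by rwa [inner_neg_right, abs_neg]⟩

theorem gauge_slabBody_le {u y : E n} {T : ℝ} (hT : 0 < T)
    (h1 : gauge K y ≤ T) (h2 : |inner ℝ u y| ≤ T) : gauge (slabBody K u) y ≤ T := by
  refine gauge_le_of_mem hT.le ((Set.mem_smul_set_iff_inv_smul_mem₀ hT.ne' _ _).2 ⟨?_, ?_⟩)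
  · rw [gauge_smul_eq_mul (by positivity), inv_mul_le_iff₀ hT]; linarith
  · rw [inner_smul_right, abs_mul, abs_of_pos (inv_pos.2 hT), inv_mul_le_iff₀ hT]; linarith

theorem gauge_le_gauge_slabBody (hK : IsSymmConvexBody K) (u y : E n) :
    gauge K y ≤ gauge (slabBody K u) y :=
  gauge_mono (isSymmConvexBody_slabBody hK u).absorbent
    (fun _ hy => hK.gauge_le_one_iff.1 hy.1) y

theorem abs_inner_le_gauge_slabBody (hK : IsSymmConvexBody K) (u y : E n) :
    |inner ℝ u y| ≤ gauge (slabBody K u) y := by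
  refine le_of_forall_gt fun a ha => ?_
  obtain ⟨b, hb, hba, x, hx, rfl⟩ :=
    exists_lt_of_gauge_lt (isSymmConvexBody_slabBody hK u).absorbent ha
  refine lt_of_le_of_lt ?_ hba
  simp only [inner_smul_right]
  rw [abs_mul, abs_of_pos hb]
  nlinarith [hx.2]

/-! ### Encoding lengths and closest lattice vectors -/

theorem abs_ratCast_le (r : ℚ) : |(r : ℝ)| ≤ 2 ^ ratLength r := by
  have h1 : |(r : ℝ)| ≤ (r.num.natAbs : ℝ) := by
    rw [Rat.cast_def, abs_div, Nat.abs_cast, Nat.cast_natAbs, Int.cast_abs]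
    exact div_le_self (abs_nonneg _) (by exact_mod_cast r.pos)
  have h2 : (r.num.natAbs : ℝ) ≤ 2 ^ Nat.size r.num.natAbs := by
    exact_mod_cast (Nat.lt_size_self _).le
  refine h1.trans (h2.trans (pow_le_pow_right₀ (by norm_num) ?_))
  unfold ratLength; omega

theorem norm_ratVec_le (A : Matrix (Fin n) (Fin n) ℚ) (t : Fin n → ℚ) :
    ‖ratVec t‖ ≤ 2 ^ (n + encLength A t) := by
  have h1 : ∀ i, |(t i : ℝ)| ≤ 2 ^ encLength A t := fun i =>
    (abs_ratCast_le (t i)).trans (pow_le_pow_right₀ (by norm_num)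
      ((Finset.single_le_sum (f := fun i => ratLength (t i)) (fun _ _ => Nat.zero_le _)
        (Finset.mem_univ i)).trans (Nat.le_add_left _ _)))
  have h2 : ‖ratVec t‖ ≤ n * 2 ^ encLength A t := by
    rw [EuclideanSpace.norm_eq]
    refine Real.sqrt_le_iff.2 ⟨by positivity, ?_⟩
    calc ∑ i, ‖ratVec t i‖ ^ 2 ≤ ∑ _i : Fin n, ((2 : ℝ) ^ encLength A t) ^ 2 :=
          Finset.sum_le_sum fun i _ => pow_le_pow_left₀ (norm_nonneg _) (h1 i) 2
      _ = n * ((2 : ℝ) ^ encLength A t) ^ 2 := by simp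
      _ ≤ _ := by
        rw [mul_pow]
        refine mul_le_mul_of_nonneg_right ?_ (by positivity)
        exact_mod_cast Nat.le_self_pow two_ne_zero n
  refine h2.trans ?_
  rw [pow_add]
  exact mul_le_mul_of_nonneg_right (by exact_mod_cast Nat.lt_two_pow_self.le) (by positivity)

theorem zero_mem_lattice (A : Matrix (Fin n) (Fin n) ℚ) : (0 : E n) ∈ lattice A :=
  ⟨0, fun i => by simp⟩

/-- Clearing denominators puts a rational lattice into `(1/d) ℤⁿ`. -/
theorem exists_denominator (A : Matrix (Fin n) (Fin n) ℚ) :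
    ∃ d : ℕ, 0 < d ∧ ∀ v ∈ lattice A, ∃ y : Fin n → ℤ, ∀ i, (d : ℝ) * v i = y i := by
  refine ⟨∏ i, ∏ j, (A i j).den, Finset.prod_pos fun i _ => Finset.prod_pos fun j _ => (A i j).pos,
    ?_⟩
  set d := ∏ i, ∏ j, (A i j).den with hd
  have hdvd : ∀ i j, ∃ k : ℤ, (d : ℝ) * (A i j : ℝ) = k := by
    intro i j
    obtain ⟨c, hc⟩ : (A i j).den ∣ d :=
      (Finset.dvd_prod_of_mem (fun j => (A i j).den) (Finset.mem_univ j)).trans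
        (Finset.dvd_prod_of_mem (fun i => ∏ j, (A i j).den) (Finset.mem_univ i))
    refine ⟨c * (A i j).num, ?_⟩
    have h0 : ((A i j).den : ℝ) ≠ 0 := by exact_mod_cast (A i j).pos.ne'
    rw [hc, Rat.cast_def]
    push_cast
    field_simp
  choose k hk using hdvd
  rintro v ⟨z, hz⟩
  refine ⟨fun i => ∑ j, k i j * z j, fun i => ?_⟩
  rw [hz, Finset.mul_sum]
  push_cast
  exact Finset.sum_congr rfl fun j _ => by rw [← mul_assoc, hk]

theorem finite_lattice_inter_closedBall (A : Matrix (Fin n) (Fin n) ℚ) (R : ℝ) :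
    (lattice A ∩ Metric.closedBall 0 R).Finite := by
  obtain ⟨d, hd, hA⟩ := exists_denominator A
  have hd' : (0 : ℝ) < d := by exact_mod_cast hd
  set M : ℤ := ⌈d * R⌉
  refine ((Set.finite_Icc (fun _ : Fin n => -M) (fun _ => M)).image
    (fun y => WithLp.toLp 2 fun i => (y i : ℝ) / d)).subset ?_
  rintro v ⟨hv, hR⟩
  rw [mem_closedBall_zero_iff] at hR
  obtain ⟨y, hy⟩ := hA v hv
  refine ⟨y, ?_, ?_⟩
  · have hb : ∀ i, |(y i : ℝ)| ≤ M := by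
      intro i
      rw [← hy, abs_mul, Nat.abs_cast]
      exact (mul_le_mul_of_nonneg_left ((PiLp.norm_apply_le v i).trans hR) hd'.le).trans
        (Int.le_ceil _)
    refine ⟨fun i => ?_, fun i => ?_⟩
    · have := (abs_le.1 (hb i)).1
      exact_mod_cast this
    · have := (abs_le.1 (hb i)).2
      exact_mod_cast this
  · ext i
    simp only [← hy]
    field_simp

theorem exists_closest (hK : IsSymmConvexBody K) (h1 : K ⊆ Metric.closedBall 0 1)
    (A : Matrix (Fin n) (Fin n) ℚ) (x : E n) :
    ∃ w ∈ lattice A, ∀ v ∈ lattice A, gauge K (w - x) ≤ gauge K (v - x) := by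
  -- Lattice vectors outside this ball are farther from `x` than `0` is.
  set R := ‖x‖ + gauge K (0 - x)
  have h0 : (0 : E n) ∈ lattice A ∩ Metric.closedBall 0 R :=
    ⟨zero_mem_lattice A, by simpa using add_nonneg (norm_nonneg _) (gauge_nonneg _)⟩
  obtain ⟨w, hw, hmin⟩ := Set.exists_min_image _ (fun v => gauge K (v - x))
    (finite_lattice_inter_closedBall A R) ⟨0, h0⟩
  refine ⟨w, hw.1, fun v hv => ?_⟩
  by_cases hvR : v ∈ Metric.closedBall 0 R
  · exact hmin v ⟨hv, hvR⟩
  · refine (hmin 0 h0).trans ?_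
    rw [mem_closedBall_zero_iff, not_le] at hvR
    have e1 := hK.norm_le_gauge h1 (v - x)
    have e2 := norm_sub_norm_le v x
    simp only [R] at hvR
    linarith

end Bodies

/-! ### Runs with cost bounds -/

section Run

variable {n : ℕ} {A : Matrix (Fin n) (Fin n) ℚ}

/-- A run of `p` from `s` to `s'` all of whose solver queries have size at most `ℓ`, and in which
the time is at most `c` times that of one such query (plus one): the space used by the solver is
bounded by every bound on the space of queries of that size, and similarly for the time. -/
def Run (K : Set (E n)) (ν : E n → E n) (S : TwoCVPSolver A) (ω : ℕ → E n) (ℓ : ℕ) (p : Prog)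
    (s s' : State n) (c : ℕ) : Prop :=
  ∃ T M : ℕ, Exec K ν S ω p s s' T M ∧
    (∀ σ, (∀ Q x, IsSymmConvexBody Q → InstanceSizeLE A Q x ℓ → S.space Q x ≤ σ) → M ≤ σ) ∧
    ∀ W, (∀ Q x, IsSymmConvexBody Q → InstanceSizeLE A Q x ℓ → S.time Q x ≤ W) → T ≤ c * (W + 1)

variable {K : Set (E n)} {ν : E n → E n} {S : TwoCVPSolver A} {ω : ℕ → E n} {ℓ : ℕ}

namespace Run

theorem mono {p : Prog} {s s' : State n} {c c' : ℕ} (h : Run K ν S ω ℓ p s s' c) (hc : c ≤ c') :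
    Run K ν S ω ℓ p s s' c' := by
  obtain ⟨T, M, h1, h2, h3⟩ := h
  exact ⟨T, M, h1, h2, fun W hW => (h3 W hW).trans (Nat.mul_le_mul_right _ hc)⟩

theorem skip (s : State n) : Run K ν S ω ℓ .skip s s 1 :=
  ⟨_, _, Exec.skip s, fun _ _ => Nat.zero_le _, fun W _ => by omega⟩

theorem assign (s : State n) (i : ℕ) (a : Expr .sc) {r : ℝ} (h : a.eval K ν s = r) :
    Run K ν S ω ℓ (.assign i a) s (s.setSc i r) (a.cost n + 1) :=
  ⟨_, _, h ▸ Exec.assign s i a, fun _ _ => Nat.zero_le _,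
    fun W _ => Nat.le_mul_of_pos_right _ W.succ_pos⟩

theorem vassign (s : State n) (i : ℕ) (u : Expr .vec) {x : E n} (h : u.eval K ν s = x) :
    Run K ν S ω ℓ (.vassign i u) s (s.setVec i x) (u.cost n + n + 1) :=
  ⟨_, _, h ▸ Exec.vassign s i u, fun _ _ => Nat.zero_le _,
    fun W _ => Nat.le_mul_of_pos_right _ W.succ_pos⟩

theorem sample (s : State n) (i : ℕ) :
    Run K ν S ω ℓ (.sample i) s { s.setVec i (ω s.pos) with pos := s.pos + 1 } (n + 1) :=
  ⟨_, _, Exec.sample s i, fun _ _ => Nat.zero_le _,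
    fun W _ => Nat.le_mul_of_pos_right _ W.succ_pos⟩

theorem solve (s : State n) (dst : ℕ) (tgt : Expr .vec) (slot : ℕ) (e : Expr .sc) {Q : Set (E n)}
    {x : E n} (hQ : bodyOf K ν s slot e = Q) (hx : tgt.eval K ν s = x) (hsymm : IsSymmConvexBody Q)
    (hsize : InstanceSizeLE A Q x ℓ) :
    Run K ν S ω ℓ (.solve dst tgt slot e) s (s.setVec dst (S.answer Q x))
      (tgt.cost n + e.cost n + 2 * n + 2) := by
  have h := Exec.solve (K := K) (ν := ν) (S := S) (ω := ω) s dst tgt slot e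
  rw [hQ, hx] at h
  refine ⟨_, _, h, fun σ hσ => hσ Q x hsymm hsize, fun W hW => ?_⟩
  have := hW Q x hsymm hsize
  nlinarith [Nat.mul_le_mul_right (e.cost n + n + 1) this]

theorem seq {p q : Prog} {s₁ s₂ s₃ : State n} {c₁ c₂ : ℕ} (h : Run K ν S ω ℓ p s₁ s₂ c₁)
    (h' : Run K ν S ω ℓ q s₂ s₃ c₂) : Run K ν S ω ℓ (.seq p q) s₁ s₃ (c₁ + c₂) := by
  obtain ⟨T, M, h1, h2, h3⟩ := h
  obtain ⟨T', M', h1', h2', h3'⟩ := h'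
  refine ⟨_, _, h1.seq h1', fun σ hσ => max_le (h2 σ hσ) (h2' σ hσ), fun W hW => ?_⟩
  rw [add_mul]
  exact add_le_add (h3 W hW) (h3' W hW)

theorem ite_true {a b : Expr .sc} {p q : Prog} {s s' : State n} {c : ℕ}
    (hab : (a.eval K ν s : ℝ) < (b.eval K ν s : ℝ)) (h : Run K ν S ω ℓ p s s' c) :
    Run K ν S ω ℓ (.ite a b p q) s s' (a.cost n + b.cost n + 1 + c) := by
  obtain ⟨T, M, h1, h2, h3⟩ := h
  refine ⟨_, _, Exec.ite_true hab h1, h2, fun W hW => ?_⟩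
  rw [add_mul]
  exact add_le_add (Nat.le_mul_of_pos_right _ W.succ_pos) (h3 W hW)

theorem ite_false {a b : Expr .sc} {p q : Prog} {s s' : State n} {c : ℕ}
    (hab : ¬ (a.eval K ν s : ℝ) < (b.eval K ν s : ℝ)) (h : Run K ν S ω ℓ q s s' c) :
    Run K ν S ω ℓ (.ite a b p q) s s' (a.cost n + b.cost n + 1 + c) := by
  obtain ⟨T, M, h1, h2, h3⟩ := h
  refine ⟨_, _, Exec.ite_false hab h1, h2, fun W hW => ?_⟩
  rw [add_mul]
  exact add_le_add (Nat.le_mul_of_pos_right _ W.succ_pos) (h3 W hW)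

/-- A loop whose `j`-th pass leads from states satisfying `I j` to states satisfying `I (j + 1)`
makes exactly `m` passes if its guard holds as long as `j < m` and fails for `j = m`. -/
theorem loop {a b : Expr .sc} {p : Prog} {m : ℕ} {I : ℕ → State n → Prop} {c : ℕ → ℕ}
    (hlt : ∀ j < m, ∀ s, I j s → (a.eval K ν s : ℝ) < (b.eval K ν s : ℝ))
    (hend : ∀ s, I m s → ¬ (a.eval K ν s : ℝ) < (b.eval K ν s : ℝ))
    (hstep : ∀ j < m, ∀ s, I j s → ∃ s', Run K ν S ω ℓ p s s' (c j) ∧ I (j + 1) s')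
    {s : State n} (hs : I 0 s) :
    ∃ s', Run K ν S ω ℓ (.loop a b p) s s'
      (a.cost n + b.cost n + 1 + ∑ j ∈ Finset.range m, (a.cost n + b.cost n + 1 + c j)) ∧
      I m s' := by
  induction m generalizing I c s with
  | zero =>
    refine ⟨s, ⟨_, _, Exec.loop_false (hend s hs), fun _ _ => Nat.zero_le _, fun W _ => ?_⟩, hs⟩
    exact Nat.le_mul_of_pos_right _ W.succ_pos
  | succ m ih =>
    obtain ⟨s₁, ⟨T, M, h1, h2, h3⟩, hI⟩ := hstep 0 m.succ_pos s hs
    obtain ⟨s', ⟨T', M', h1', h2', h3'⟩, hI'⟩ := ih (I := fun j => I (j + 1))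
      (c := fun j => c (j + 1)) (fun j hj => hlt (j + 1) (by omega)) hend
      (fun j hj => hstep (j + 1) (by omega)) hI
    refine ⟨s', ⟨_, _, Exec.loop_true (hlt 0 m.succ_pos s hs) h1 h1',
      fun σ hσ => max_le (h2 σ hσ) (h2' σ hσ), fun W hW => ?_⟩, hI'⟩
    rw [Finset.sum_range_succ']
    have e1 := h3 W hW
    have e2 := h3' W hW
    have e3 := Nat.le_mul_of_pos_right (a.cost n + b.cost n + 1) W.succ_pos
    simp only [Nat.succ_eq_add_one] at e3
    linarith [add_mul (a.cost n + b.cost n + 1) (c 0) (W + 1)]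

end Run

end Run

/-! ### The program -/

/-- The distance `‖vᵢ - t‖_K` of the vector in register `i` to the target. -/
def distExpr (i : ℕ) : Expr .sc := .norm (.vadd (.vvar i) (.smul (.const (-1)) (.vvar 0)))

/-- The radius of the neighbourhood explored in one trial, in units of `r₀`; see `trialWidth`. -/
def widthExpr : Expr .sc :=
  .max (.mul (.svar 7) (.const (1 / 4)))
    (.mul (.const (1 / 4))
      (.exp (.div (.log (.div (.svar 7) (.mul (.const 32) (.svar 2)))) (.svar 3))))

/-- The number of trials of a stage; see `trialCount`. -/
def countExpr : Expr .sc :=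
  .mul (.svar 8) (.exp (.mul (.svar 0) (.log (.div (.const 32) (.svar 9)))))

/-- One trial: project the sample in vector register `2` to the unit sphere, and call the solver on
a slab of `K` that is parallel to the supporting hyperplane there. The best lattice vector found so
far and its distance are kept in vector register `1` and scalar register `5`. -/
def trial : Prog :=
  .seq (.vassign 3 (.smul (.div (.const 1) (.norm (.vvar 2))) (.vvar 2)))
  (.seq (.vassign 4 (.smul (.div (.div (.mul (.const 4) (.svar 9)) (.svar 7))
      (.dot (.normal (.vvar 3)) (.vvar 3))) (.normal (.vvar 3))))
  (.seq (.solve 5 (.vadd (.vvar 0) (.smul (.sub (.svar 5)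
      (.mul (.const (7 / 8)) (.mul (.svar 4) (.svar 7)))) (.vvar 3))) 6
      (.max (.norm (.vvar 6)) (.max (.dot (.vvar 4) (.vvar 6))
        (.mul (.const (-1)) (.dot (.vvar 4) (.vvar 6))))))
    (.ite (distExpr 5) (.svar 5) (.seq (.vassign 1 (.vvar 5)) (.assign 5 (distExpr 1))) .skip)))

/-- One pass of the inner loop: draw a sample and, unless it is zero, make a trial with it. -/
def sampleAndTry : Prog :=
  .seq (.sample 2) (.seq (.ite (.const 0) (.norm (.vvar 2)) trial .skip)
    (.assign 11 (.add (.svar 11) (.const 1))))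

/-- One stage: make sufficiently many trials to improve the relative gap `s`, in scalar register
`7`, by the factor `3 / 4`. -/
def stage : Prog :=
  .seq (.assign 9 widthExpr) (.seq (.assign 10 countExpr) (.seq (.assign 11 (.const 0))
  (.seq (.loop (.svar 11) (.svar 10) sampleAndTry)
  (.seq (.assign 7 (.mul (.const (3 / 4)) (.svar 7)))
    (.assign 8 (.add (.svar 8) (.const 1)))))))

/-- The whole algorithm: start with a 2-approximate closest vector and run stages until the relative
gap is at most `ε`. The scalar registers hold the input in `0` to `3`, half the initial distance `r₀`
in `4`, the current distance `D` in `5`, the gap `s` in `7`, the number `n + 1 + j` in `8`, the width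
`τ` in `9`, and the number and the index of trials in `10` and `11`. -/
def boost : Prog :=
  .seq (.solve 1 (.vvar 0) 6 (.norm (.vvar 6)))
  (.seq (.assign 5 (distExpr 1))
  (.seq (.assign 4 (.mul (.const (1 / 2)) (.svar 5)))
  (.seq (.assign 7 (.const 1))
  (.seq (.assign 8 (.add (.svar 0) (.const 1)))
    (.loop (.svar 1) (.svar 7) stage)))))

theorem cells_boost_le {n : ℕ} (hn : 1 ≤ n) : boost.cells n ≤ 200 * n := by
  simp only [boost, stage, sampleAndTry, trial, distExpr, widthExpr, countExpr, Prog.cells,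
    Expr.cells]
  omega

/-- The value of `widthExpr`: the radius of the explored neighbourhood, in units of `r₀`, for the
gap `s`. The first alternative is the radius for which the triangle inequality suffices, the second
one the largest radius for which smoothness gives an error of order `s`. -/
noncomputable def trialWidth (C q s : ℝ) : ℝ :=
  max (s * (1 / 4)) (1 / 4 * Real.exp (Real.log (s / (32 * C)) / q))

/-- The value of `countExpr`: `k (32 / τ) ^ n`. -/
noncomputable def trialCount (n : ℕ) (k τ : ℝ) : ℝ := k * Real.exp (n * Real.log (32 / τ))

/-- The supporting normal at `p`, scaled to have inner product `c` with `p`. -/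
noncomputable def scaledNormal {n : ℕ} (ν : E n → E n) (c : ℝ) (p : E n) : E n :=
  (c / inner ℝ (ν p) p) • ν p

section trial

variable {n : ℕ} {A : Matrix (Fin n) (Fin n) ℚ} {K : Set (E n)} {ν : E n → E n}
  {S : TwoCVPSolver A} {ω : ℕ → E n} {ℓ : ℕ}

theorem eval_distExpr (s : State n) (i : ℕ) :
    (distExpr i).eval K ν s = gauge K (s.vec i - s.vec 0) := by
  simp [distExpr, Expr.eval, sub_eq_add_neg]

theorem bodyOf_slab (s : State n) :
    bodyOf K ν s 6 (.max (.norm (.vvar 6)) (.max (.dot (.vvar 4) (.vvar 6))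
        (.mul (.const (-1)) (.dot (.vvar 4) (.vvar 6))))) = slabBody K (s.vec 4) := by
  ext x
  simp [bodyOf, slabBody, Expr.eval, State.setVec, abs_le, and_comm, neg_le]

theorem bodyOf_norm (s : State n) : bodyOf K ν s 6 (.norm (.vvar 6)) = slabBody K 0 := by
  ext x
  simp [bodyOf, slabBody, Expr.eval, State.setVec]

theorem run_trial (hn : 1 ≤ n) (hK : IsSymmConvexBody K) {s : State n} {p x u : E n}
    (hp : p = (1 / gauge K (s.vec 2)) • s.vec 2)
    (hu : u = scaledNormal ν (4 * s.sc 9 / s.sc 7) p)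
    (hx : x = s.vec 0 + (s.sc 5 - 7 / 8 * (s.sc 4 * s.sc 7)) • p)
    (hsize : InstanceSizeLE A (slabBody K u) x ℓ) (hlat : s.vec 1 ∈ lattice A)
    (h5 : s.sc 5 = gauge K (s.vec 1 - s.vec 0)) :
    ∃ s', Run K ν S ω ℓ trial s s' (200 * n) ∧ s'.pos = s.pos ∧ (∀ i ≠ 5, s'.sc i = s.sc i) ∧
      s'.vec 0 = s.vec 0 ∧ s'.vec 1 ∈ lattice A ∧ s'.sc 5 = gauge K (s'.vec 1 - s'.vec 0) ∧
      s'.sc 5 ≤ s.sc 5 ∧ s'.sc 5 ≤ gauge K (S.answer (slabBody K u) x - s.vec 0) := by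
  set v := S.answer (slabBody K u) x with hv
  have hvlat : v ∈ lattice A := (S.correct _ (isSymmConvexBody_slabBody hK u) x).1
  set s₃ := ((s.setVec 3 p).setVec 4 u).setVec 5 v with hs₃
  have hrun : ∀ s' c, Run K ν S ω ℓ (.ite (distExpr 5) (.svar 5)
      (.seq (.vassign 1 (.vvar 5)) (.assign 5 (distExpr 1))) .skip) s₃ s' c → c ≤ 50 * n →
      Run K ν S ω ℓ trial s s' (200 * n) := by
    intro s' c h hc
    refine ((Run.vassign s 3 _ (x := p) ?_).seq ((Run.vassign _ 4 _ (x := u) ?_).seq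
      ((Run.solve _ 5 _ 6 _ (bodyOf_slab _) (x := x) ?_ ?_ ?_).seq (s₃ := s') (c₂ := c) ?_))).mono ?_
    · simp [hp, Expr.eval]
    · simp [hu, Expr.eval, State.setVec, scaledNormal]
    · simp [Expr.eval, State.setVec, hx]
    · exact isSymmConvexBody_slabBody hK _
    · simpa [State.setVec] using hsize
    · convert h using 1
      simp [hs₃, hv, State.setVec]
    · simp only [Expr.cost]
      omega
  have h3d : (distExpr 5).eval K ν s₃ = gauge K (v - s.vec 0) := by
    rw [eval_distExpr]; simp [hs₃, State.setVec]
  by_cases hlt : gauge K (v - s.vec 0) < s.sc 5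
  · refine ⟨(s₃.setVec 1 v).setSc 5 (gauge K (v - s.vec 0)),
      hrun _ _ (Run.ite_true (by rw [h3d]; exact hlt)
        ((Run.vassign s₃ 1 (.vvar 5) rfl).seq (Run.assign _ 5 (distExpr 1) ?_))) ?_, ?_⟩
    · rw [eval_distExpr]; simp [hs₃, State.setVec, Expr.eval]
    · simp only [distExpr, Expr.cost]; omega
    · refine ⟨rfl, fun i hi => Function.update_of_ne hi _ _, ?_, ?_, ?_, ?_, ?_⟩ <;>
        simp [hs₃, State.setVec, State.setSc, hvlat, hlt.le]
  · refine ⟨s₃, hrun _ _ (Run.ite_false (by rw [h3d]; exact hlt) (Run.skip _)) ?_, ?_⟩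
    · simp only [distExpr, Expr.cost]; omega
    · refine ⟨rfl, fun _ _ => rfl, ?_, ?_, ?_, le_refl _, not_lt.1 hlt⟩ <;>
        simp [hs₃, State.setVec, hlat, h5]

end trial

/-! ### Widths and numbers of trials -/

section Width

variable {C q s : ℝ}

theorem trialWidth_eq_max (C q s : ℝ) :
    trialWidth C q s = max (s / 4) (1 / 4 * Real.exp (Real.log (s / (32 * C)) / q)) := by
  rw [trialWidth]; congr 1; ring

theorem div_four_le_trialWidth (C q s : ℝ) : s / 4 ≤ trialWidth C q s :=
  trialWidth_eq_max C q s ▸ le_max_left _ _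

theorem smooth_width_lt (hC : 1 < C) (hq : 1 < q) (hs : 0 < s) (hs1 : s ≤ 1) :
    4 * (1 / 4 * Real.exp (Real.log (s / (32 * C)) / q)) < 1 := by
  have h1 : s / (32 * C) < 1 := by rw [div_lt_one (by linarith)]; linarith
  have h2 : Real.log (s / (32 * C)) / q < 0 :=
    div_neg_of_neg_of_pos (Real.log_neg (div_pos hs (by linarith)) h1) (by linarith)
  have := Real.exp_lt_exp.2 h2
  rw [Real.exp_zero] at this
  linarith

theorem trialWidth_le (hC : 1 < C) (hq : 1 < q) (hs : 0 < s) (hs1 : s ≤ 1) :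
    trialWidth C q s ≤ 1 / 4 := by
  rw [trialWidth_eq_max]
  exact max_le (by linarith) (by linarith [smooth_width_lt hC hq hs hs1])

/-- The smooth width is chosen such that the error that smoothness allows is at most `s / 32`. -/
theorem mul_smooth_width_rpow_le (hC : 1 < C) (hq : 1 < q) (hs : 0 < s) :
    C * (4 * (1 / 4 * Real.exp (Real.log (s / (32 * C)) / q))) ^ q ≤ s / 32 := by
  have hpos : 0 < s / (32 * C) := div_pos hs (by linarith)
  rw [← mul_assoc, show (4 : ℝ) * (1 / 4) = 1 by norm_num, one_mul, ← Real.exp_mul,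
    div_mul_cancel₀ _ (by linarith), Real.exp_log hpos]
  apply le_of_eq
  field_simp

theorem trialCount_eq (n : ℕ) (k : ℝ) {τ : ℝ} (hτ : 0 < τ) :
    trialCount n k τ = k * (32 / τ) ^ n := by
  rw [trialCount, Real.exp_nat_mul, Real.exp_log (by positivity)]

/-- The number of trials made in stage `j`, in which the gap is `(3 / 4) ^ j`. -/
noncomputable def stageTrials (n : ℕ) (C q : ℝ) (j : ℕ) : ℕ :=
  ⌈trialCount n (n + 1 + j) (trialWidth C q ((3 / 4) ^ j))⌉₊

/-- The number of samples used before stage `j`. -/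
noncomputable def stageStart (n : ℕ) (C q : ℝ) (j : ℕ) : ℕ :=
  ∑ i ∈ Finset.range j, stageTrials n C q i

theorem stageTrials_le {ε : ℝ} (n : ℕ) (hC : 1 < C) (hq : 1 < q) (hε : 0 < ε) {j : ℕ}
    (hj : ε ≤ (3 / 4) ^ j) :
    (stageTrials n C q j : ℝ) ≤
      (n + 1 + j) * (2 ^ (12 * n) * C ^ ((n : ℝ) / q) * (1 / ε) ^ ((n : ℝ) / q)) + 1 := by
  set s : ℝ := (3 / 4) ^ j with hs
  have hs0 : 0 < s := by positivity
  set w := Real.exp (Real.log (s / (32 * C)) / q) with hw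
  have hw0 : 0 < w := Real.exp_pos _
  have hτw : 1 / 4 * w ≤ trialWidth C q s := le_max_right _ _
  have hτ0 : 0 < trialWidth C q s := lt_of_lt_of_le (by positivity) hτw
  have h1 : (32 / trialWidth C q s) ^ n ≤ (128 / w) ^ n := by
    refine pow_le_pow_left₀ (by positivity) ?_ n
    rw [div_le_div_iff₀ hτ0 hw0]; linarith
  have h2 : (1 / w) ^ n = (32 * C / s) ^ ((n : ℝ) / q) := by
    have hpos : 0 < s / (32 * C) := by positivity
    rw [hw, one_div, ← Real.exp_neg, ← Real.exp_nat_mul, Real.rpow_def_of_pos (by positivity),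
      ← inv_div s, Real.log_inv]
    congr 1
    ring
  have h3 : (32 * C / s) ^ ((n : ℝ) / q) ≤
      32 ^ n * (C ^ ((n : ℝ) / q) * (1 / ε) ^ ((n : ℝ) / q)) := by
    have e1 : (32 * C / s) ^ ((n : ℝ) / q) ≤ (32 * (C * (1 / ε))) ^ ((n : ℝ) / q) := by
      refine Real.rpow_le_rpow (by positivity) ?_ (by positivity)
      rw [div_le_iff₀ hs0]
      have : 1 ≤ 1 / ε * s := by rw [div_mul_eq_mul_div, one_mul, le_div_iff₀ hε]; linarith
      nlinarith
    rw [Real.mul_rpow (by norm_num) (by positivity), Real.mul_rpow (by positivity) (by positivity)]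
      at e1
    refine e1.trans (mul_le_mul_of_nonneg_right ?_ (by positivity))
    rw [← Real.rpow_natCast]
    exact Real.rpow_le_rpow_of_exponent_le (by norm_num) (div_le_self (by positivity) hq.le)
  rw [stageTrials]
  refine (Nat.ceil_lt_add_one ?_).le.trans (add_le_add_left ?_ 1)
  · rw [trialCount]; positivity
  rw [trialCount_eq n _ hτ0]
  refine mul_le_mul_of_nonneg_left (h1.trans ?_) (by positivity)
  calc (128 / w) ^ n = 128 ^ n * (1 / w) ^ n := by rw [← mul_pow]; congr 1; ring
    _ ≤ 128 ^ n * (32 ^ n * (C ^ ((n : ℝ) / q) * (1 / ε) ^ ((n : ℝ) / q))) := by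
      rw [h2]; exact mul_le_mul_of_nonneg_left h3 (by positivity)
    _ = _ := by
      rw [pow_mul, show ((2 : ℝ) ^ 12) = 128 * 32 by norm_num, mul_pow]; ring

end Width

/-! ### The probability of success -/

section Probability

variable {n : ℕ} {K : Set (E n)}

/-- The points at `K`-distance at most `τ / 32` from `e / 2`. For a unit vector `e`, all of them have
direction close to that of `e`. -/
def hitSet (K : Set (E n)) (e : E n) (τ : ℝ) : Set (E n) :=
  {x | gauge K (x - (1 / 2 : ℝ) • e) ≤ τ / 32}

theorem measurableSet_hitSet (hK : IsSymmConvexBody K) (e : E n) (τ : ℝ) :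
    MeasurableSet (hitSet K e τ) := by
  have := continuous_gauge hK.convex hK.mem_nhds_zero
  exact (isClosed_le (by fun_prop) continuous_const).measurableSet

open scoped Pointwise in
/-- The hitting set is a translate of `(τ / 32) K` inside `K`. -/
theorem cond_hitSet (hK : IsSymmConvexBody K) {e : E n} (he : gauge K e ≤ 1) {τ : ℝ} (hτ : 0 < τ)
    (hτ1 : τ ≤ 1) :
    ProbabilityTheory.cond volume K (hitSet K e τ) = ENNReal.ofReal ((τ / 32) ^ n) := by
  have hc : 0 < τ / 32 := by positivity
  have hsub : hitSet K e τ ⊆ K := by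
    intro x hx
    rw [← hK.gauge_le_one_iff]
    have h1 := map_add_le_add hK.seminorm (x - (1 / 2 : ℝ) • e) ((1 / 2 : ℝ) • e)
    simp only [hK.seminorm_apply, sub_add_cancel] at h1
    rw [gauge_smul_eq_mul (by norm_num)] at h1
    have h2 : gauge K (x - (1 / 2 : ℝ) • e) ≤ τ / 32 := hx
    linarith
  have hpre : hitSet K e τ = (fun x => x + -((1 / 2 : ℝ) • e)) ⁻¹' ((τ / 32) • K) := by
    ext x
    rw [Set.mem_preimage, Set.mem_smul_set_iff_inv_smul_mem₀ hc.ne', ← hK.gauge_le_one_iff,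
      gauge_smul_eq_mul (by positivity), inv_mul_le_iff₀ hc, mul_one, ← sub_eq_add_neg]
    rfl
  have hvol : volume (hitSet K e τ) = ENNReal.ofReal ((τ / 32) ^ n) * volume K := by
    rw [hpre, measure_preimage_add_right, Measure.addHaar_smul_of_nonneg _ hc.le,
      finrank_euclideanSpace_fin]
  have h0 : volume K ≠ 0 := (Measure.measure_pos_of_nonempty_interior _ hK.interior_nonempty).ne'
  rw [cond_apply hK.isCompact.isClosed.measurableSet, Set.inter_eq_right.2 hsub, hvol, mul_comm,
    mul_assoc, ENNReal.mul_inv_cancel h0 hK.isCompact.measure_lt_top.ne, mul_one]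

/-- In each of the stages before stage `m`, some sample lies in the hitting set of that stage. -/
def Lucky (K : Set (E n)) (C q : ℝ) (e : E n) (m : ℕ) (ω : ℕ → E n) : Prop :=
  ∀ j < m, ∃ i < stageTrials n C q j,
    ω (stageStart n C q j + i) ∈ hitSet K e (trialWidth C q ((3 / 4) ^ j))

variable {Ω : Type*} [MeasurableSpace Ω] {P : Measure Ω} [IsProbabilityMeasure P] {X : ℕ → Ω → E n}

theorem measure_forall_notMem_le (hX : ∀ k, Measurable (X k)) (hind : iIndepFun X P) {G : Set (E n)}
    (hG : MeasurableSet G) {p : ℝ} (hp : 0 ≤ p) (hp1 : p ≤ 1)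
    (hPG : ∀ k, P.map (X k) G = ENNReal.ofReal p) (a c k : ℕ) (hc : k ≤ c * p) :
    P {o | ¬ ∃ i < c, X (a + i) o ∈ G} ≤ ENNReal.ofReal ((1 / 2) ^ k) := by
  have hset : {o | ¬ ∃ i < c, X (a + i) o ∈ G} =
      ⋂ i ∈ Finset.Ico a (a + c), X i ⁻¹' Gᶜ := by
    ext o
    simp only [Set.mem_iInter, Finset.mem_Ico, Set.mem_preimage, Set.mem_compl_iff,
      Set.mem_ofPred_eq, not_exists, not_and]
    constructor
    · intro h i hi
      have := h (i - a) (by omega)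
      rwa [Nat.add_sub_cancel' hi.1] at this
    · intro h i hi
      exact h (a + i) (by omega)
  have hmiss : ∀ i, P (X i ⁻¹' Gᶜ) = ENNReal.ofReal (1 - p) := by
    intro i
    rw [← Measure.map_apply (hX i) hG.compl]
    have : IsProbabilityMeasure (P.map (X i)) := Measure.isProbabilityMeasure_map (hX i).aemeasurable
    rw [prob_compl_eq_one_sub hG, hPG, ENNReal.ofReal_sub _ hp, ENNReal.ofReal_one]
  rw [hset, hind.measure_inter_preimage_eq_mul _ (fun _ _ => hG.compl)]
  simp only [hmiss, Finset.prod_const, Nat.card_Ico, Nat.add_sub_cancel_left]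
  rw [← ENNReal.ofReal_pow (by linarith)]
  refine ENNReal.ofReal_le_ofReal ?_
  have h1 : 1 - p ≤ Real.exp (-p) := by linarith [Real.add_one_le_exp (-p)]
  have h2 : Real.exp (-1) ≤ 1 / 2 := by
    rw [Real.exp_neg, one_div]
    exact inv_anti₀ (by norm_num) (by linarith [Real.add_one_le_exp (1 : ℝ)])
  calc (1 - p) ^ c ≤ Real.exp (-p) ^ c := pow_le_pow_left₀ (by linarith) h1 c
    _ = Real.exp (-(c * p)) := by rw [← Real.exp_nat_mul]; congr 1; ring
    _ ≤ Real.exp (k * (-1)) := Real.exp_le_exp.2 (by linarith)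
    _ = Real.exp (-1) ^ k := Real.exp_nat_mul _ _
    _ ≤ (1 / 2) ^ k := pow_le_pow_left₀ (Real.exp_pos _).le h2 k

/-- Since the hitting sets do not depend on the course of the algorithm, no conditioning is needed:
stage `j` fails with probability at most `2 ^ (-(n + 1 + j))`, and a union bound suffices. -/
theorem measure_not_lucky_le (hK : IsSymmConvexBody K) {C q : ℝ} (hC : 1 < C) (hq : 1 < q)
    (hX : ∀ k, Measurable (X k)) (hind : iIndepFun X P)
    (hlaw : ∀ k, P.map (X k) = ProbabilityTheory.cond volume K) {e : E n} (he : gauge K e ≤ 1)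
    (m : ℕ) :
    P {o | ¬ Lucky K C q e m (fun k => X k o)} ≤ ENNReal.ofReal ((2 : ℝ) ^ (-(n : ℝ))) := by
  have hstage : ∀ j, P {o | ¬ ∃ i < stageTrials n C q j,
      X (stageStart n C q j + i) o ∈ hitSet K e (trialWidth C q ((3 / 4) ^ j))} ≤
      ENNReal.ofReal ((1 / 2) ^ (n + 1 + j)) := by
    intro j
    have hs0 : (0 : ℝ) < (3 / 4) ^ j := by positivity
    have hs1 : ((3 : ℝ) / 4) ^ j ≤ 1 := pow_le_one₀ (by norm_num) (by norm_num)
    set τ := trialWidth C q ((3 / 4) ^ j) with hτ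
    have hτ0 : 0 < τ := lt_of_lt_of_le (by positivity) (div_four_le_trialWidth C q _)
    have hτ1 : τ ≤ 1 / 4 := trialWidth_le hC hq hs0 hs1
    refine measure_forall_notMem_le hX hind (p := (τ / 32) ^ n) (measurableSet_hitSet hK e τ) (by positivity)
      (pow_le_one₀ (by positivity) (by linarith))
      (fun k => by rw [hlaw, cond_hitSet hK he hτ0 (by linarith)]) _ _ _ ?_
    have h1 : ((n + 1 + j : ℕ) : ℝ) = (n + 1 + j) * (32 / τ) ^ n * (τ / 32) ^ n := by
      rw [mul_assoc, ← mul_pow, show 32 / τ * (τ / 32) = 1 by field_simp, one_pow, mul_one]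
      push_cast; ring
    rw [h1]
    refine mul_le_mul_of_nonneg_right ?_ (by positivity)
    rw [stageTrials, ← hτ, trialCount_eq n _ hτ0]
    exact Nat.le_ceil _
  have hsub : {o | ¬ Lucky K C q e m (fun k => X k o)} ⊆ ⋃ j ∈ Finset.range m,
      {o | ¬ ∃ i < stageTrials n C q j,
        X (stageStart n C q j + i) o ∈ hitSet K e (trialWidth C q ((3 / 4) ^ j))} := by
    intro o ho
    simp only [Lucky, Set.mem_ofPred_eq, not_forall] at ho
    obtain ⟨j, hj, h⟩ := ho
    exact Set.mem_biUnion (by simpa using hj) h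
  refine (measure_mono hsub).trans ((measure_biUnion_finset_le _ _).trans
    ((Finset.sum_le_sum fun j _ => hstage j).trans ?_))
  rw [← ENNReal.ofReal_sum_of_nonneg (fun _ _ => by positivity)]
  refine ENNReal.ofReal_le_ofReal ?_
  simp only [pow_add (1 / 2 : ℝ) (n + 1)]
  rw [← Finset.mul_sum, Real.rpow_neg (by norm_num), Real.rpow_natCast]
  calc (1 / 2 : ℝ) ^ (n + 1) * ∑ i ∈ Finset.range m, (1 / 2 : ℝ) ^ i
      ≤ (1 / 2 : ℝ) ^ (n + 1) * 2 :=
        mul_le_mul_of_nonneg_left (sum_geometric_two_le m) (by positivity)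
    _ = ((2 : ℝ) ^ n)⁻¹ := by rw [pow_succ, one_div, inv_pow]; ring

end Probability

section Correctness

/-! ### Correctness and cost of the program -/

variable {n : ℕ} {K : Set (E n)} {ν : E n → E n} {A : Matrix (Fin n) (Fin n) ℚ}

theorem inner_scaledNormal (c : ℝ) (p y : E n) :
    inner ℝ (scaledNormal ν c p) y = c * inner ℝ (scaledNormal ν 1 p) y := by
  simp only [scaledNormal, real_inner_smul_left]
  ring

theorem inner_scaledNormal_self (hK : IsSymmConvexBody K) (hν : IsSupportOracle K ν) {p : E n}
    (hp : gauge K p = 1) : inner ℝ (scaledNormal ν 1 p) p = 1 := by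
  rw [scaledNormal, real_inner_smul_left,
    one_div_mul_cancel (hK.inner_pos_of_support (hν p hp).1 (hν p hp).2).ne']

theorem inner_scaledNormal_le (hK : IsSymmConvexBody K) (hν : IsSupportOracle K ν) {p : E n}
    (hp : gauge K p = 1) (y : E n) : inner ℝ (scaledNormal ν 1 p) y ≤ gauge K y := by
  have := hK.inner_div_le_gauge (hν p hp).1 (hν p hp).2 y
  rwa [scaledNormal, real_inner_smul_left, one_div_mul_eq_div]

theorem abs_inner_scaledNormal_le (hK : IsSymmConvexBody K) (hν : IsSupportOracle K ν) {p : E n}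
    (hp : gauge K p = 1) {c : ℝ} (hc : 0 ≤ c) (y : E n) :
    |inner ℝ (scaledNormal ν c p) y| ≤ c * gauge K y := by
  rw [inner_scaledNormal, abs_mul, abs_of_nonneg hc]
  refine mul_le_mul_of_nonneg_left (abs_le'.2 ⟨inner_scaledNormal_le hK hν hp y, ?_⟩) hc
  have := inner_scaledNormal_le hK hν hp (-y)
  rwa [inner_neg_right, gauge_neg hK.neg_mem] at this

/-- If the distance `‖w - t‖_K` is at most `D - 3/4 g`, `g = r₀ s`, then a trial with a sample that
hits the set attached to `w - t` yields a lattice vector at distance at most `D - g / 4`. -/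
theorem gauge_answer_sub_le (hK : IsSymmConvexBody K) (hν : IsSupportOracle K ν) {C q : ℝ}
    (hC : 1 < C) (hq : 1 < q) (hsm : HasPowerSmoothness hK.seminorm C q) {r₀ s D : ℝ}
    {t w v x : E n} (hw : w ∈ lattice A) (hr₀ : 0 < r₀) (hs : 0 < s) (hs1 : s ≤ 1)
    (hr : r₀ ≤ gauge K (w - t)) (hD : D ≤ 2 * r₀) (h1 : D ≤ gauge K (w - t) + r₀ * s)
    (h2 : gauge K (w - t) + 3 / 4 * (r₀ * s) ≤ D)
    (hx : x ∈ hitSet K ((gauge K (w - t))⁻¹ • (w - t)) (trialWidth C q s))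
    (hv : IsApproxClosest 2
      (slabBody K (scaledNormal ν (4 * trialWidth C q s / s) ((1 / gauge K x) • x))) A
      (t + (D - 7 / 8 * (r₀ * s)) • ((1 / gauge K x) • x)) v) :
    gauge K (v - t) ≤ D - r₀ * s / 4 := by
  set N := hK.seminorm with hN
  set τ := trialWidth C q s with hτ
  set e := (gauge K (w - t))⁻¹ • (w - t) with he
  have hsτ : s / 4 ≤ τ := div_four_le_trialWidth C q s
  have hτ0 : 0 < τ := by linarith
  have hwt : 0 < gauge K (w - t) := by linarith
  have he1 : N e = 1 := by
    rw [hN, hK.seminorm_apply, he, gauge_smul_eq_mul (by positivity), inv_mul_cancel₀ hwt.ne']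
  obtain ⟨hx0, hclose⟩ := N.sub_normalize_le he1 (by linarith [trialWidth_le hC hq hs hs1]) hx
  have hxK : N x = gauge K x := rfl
  rw [hxK] at hx0 hclose
  rw [← one_div] at hclose
  set p := (1 / gauge K x) • x with hp
  have hp1 : gauge K p = 1 := by
    rw [hp, gauge_smul_eq_mul (by positivity), one_div_mul_cancel hx0.ne']
  refine N.le_of_two_approx (innerSL ℝ (scaledNormal ν 1 p)).toLinearMap
    (fun y => inner_scaledNormal_le hK hν hp1 y) hsm (by linarith) (by linarith) hp1
    (inner_scaledNormal_self hK hν hp1) hr₀ hs hs1 hr hD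
    (by rw [hN, hK.seminorm_apply]; linarith) (by rw [hN, hK.seminorm_apply]; linarith)
    (trialWidth_eq_max C q s) (by positivity) (smooth_width_lt hC hq hs hs1)
    (mul_smooth_width_rpow_le hC hq hs) hclose ?_
  intro T hT g1 g2
  have habs : ∀ y : E n, 4 * τ / s * |inner ℝ (scaledNormal ν 1 p) y| =
      |inner ℝ (scaledNormal ν (4 * τ / s) p) y| := by
    intro y
    have hc : 0 ≤ 4 * τ / s := by positivity
    rw [inner_scaledNormal (4 * τ / s), abs_mul, abs_of_nonneg hc]
  have hle := hv.2 w hw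
  rw [← sub_sub, ← sub_sub] at hle
  have hg := gauge_slabBody_le hT g1 (by rw [← habs]; exact g2)
  refine ⟨?_, ?_⟩
  · exact (gauge_le_gauge_slabBody hK _ _).trans (hle.trans (by linarith))
  · refine (habs _).le.trans ?_
    exact (abs_inner_le_gauge_slabBody hK _ _).trans (hle.trans (by linarith))

/-- The standing assumptions on a run of the algorithm: `w` is a lattice vector to be competed with,
`r₀` a lower bound for its distance to the target, and `ℓ` bounds the size of the queries that
trials make. The last field says that `K` lies in the Euclidean unit ball. -/
structure Setting (K : Set (E n)) (ν : E n → E n) (A : Matrix (Fin n) (Fin n) ℚ) (t : Fin n → ℚ)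
    (ε C q r₀ : ℝ) (w : E n) (ℓ : ℕ) : Prop where
  one_le : 1 ≤ n
  body : IsSymmConvexBody K
  support : IsSupportOracle K ν
  one_lt_C : 1 < C
  one_lt_q : 1 < q
  smooth : HasPowerSmoothness body.seminorm C q
  eps_pos : 0 < ε
  mem : w ∈ lattice A
  nonneg : 0 ≤ r₀
  le_dist : r₀ ≤ gauge K (w - ratVec t)
  size : ∀ (p : E n) (c : ℝ) (x : E n), gauge K p = 1 → 1 ≤ c → c ≤ 1 / ε →
    ‖x‖ ≤ ‖ratVec t‖ + 2 * r₀ → InstanceSizeLE A (slabBody K (scaledNormal ν c p)) x ℓ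
  norm_le : ∀ p : E n, ‖p‖ ≤ gauge K p

/-- The part of the memory contents that makes sense throughout the algorithm. -/
structure Frame (K : Set (E n)) (A : Matrix (Fin n) (Fin n) ℚ) (t : Fin n → ℚ) (ε C q r₀ : ℝ)
    (s : State n) : Prop where
  dim : s.sc 0 = n
  eps : s.sc 1 = ε
  const : s.sc 2 = C
  exponent : s.sc 3 = q
  radius : s.sc 4 = r₀
  target : s.vec 0 = ratVec t
  mem : s.vec 1 ∈ lattice A
  dist : s.sc 5 = gauge K (s.vec 1 - s.vec 0)
  dist_le : s.sc 5 ≤ 2 * r₀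

/-- The loop invariant of the outer loop, before stage `j`. -/
structure StageInv (K : Set (E n)) (A : Matrix (Fin n) (Fin n) ℚ) (t : Fin n → ℚ) (ε C q r₀ : ℝ)
    (w : E n) (ω : ℕ → E n) (j : ℕ) (s : State n) : Prop extends Frame K A t ε C q r₀ s where
  gap : s.sc 7 = (3 / 4) ^ j
  counter : s.sc 8 = n + 1 + j
  pos : s.pos = stageStart n C q j
  good : Lucky K C q ((gauge K (w - ratVec t))⁻¹ • (w - ratVec t)) j ω →
    s.sc 5 ≤ gauge K (w - ratVec t) + r₀ * (3 / 4) ^ j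

/-- The loop invariant of the inner loop, after `i` trials of stage `j`. -/
structure TrialInv (K : Set (E n)) (A : Matrix (Fin n) (Fin n) ℚ) (t : Fin n → ℚ) (ε C q r₀ : ℝ)
    (w : E n) (ω : ℕ → E n) (j i : ℕ) (s : State n) : Prop extends Frame K A t ε C q r₀ s where
  gap : s.sc 7 = (3 / 4) ^ j
  counter : s.sc 8 = n + 1 + j
  width : s.sc 9 = trialWidth C q ((3 / 4) ^ j)
  count : s.sc 10 = trialCount n (n + 1 + j) (trialWidth C q ((3 / 4) ^ j))
  index : s.sc 11 = i
  pos : s.pos = stageStart n C q j + i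
  good : Lucky K C q ((gauge K (w - ratVec t))⁻¹ • (w - ratVec t)) j ω →
    s.sc 5 ≤ gauge K (w - ratVec t) + r₀ * (3 / 4) ^ j
  hit : Lucky K C q ((gauge K (w - ratVec t))⁻¹ • (w - ratVec t)) j ω →
    (∃ k < i, ω (stageStart n C q j + k) ∈
      hitSet K ((gauge K (w - ratVec t))⁻¹ • (w - ratVec t)) (trialWidth C q ((3 / 4) ^ j))) →
    s.sc 5 ≤ gauge K (w - ratVec t) + 3 / 4 * (r₀ * (3 / 4) ^ j)

variable {t : Fin n → ℚ} {ε C q r₀ : ℝ} {w : E n} {ℓ : ℕ} {ω : ℕ → E n}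

theorem lucky_succ {e : E n} {j : ℕ} : Lucky K C q e (j + 1) ω ↔ Lucky K C q e j ω ∧
    ∃ i < stageTrials n C q j,
      ω (stageStart n C q j + i) ∈ hitSet K e (trialWidth C q ((3 / 4) ^ j)) :=
  Nat.forall_lt_succ_right

/-- A trial preserves the invariant of the inner loop. By `gauge_answer_sub_le`, a hit decreases the
distance by a quarter of the gap, unless the distance is already good enough. -/
theorem run_sampleAndTry (h : Setting K ν A t ε C q r₀ w ℓ) (S : TwoCVPSolver A) {j i : ℕ}
    (hj : ε < (3 / 4) ^ j) {s : State n} (hs : TrialInv K A t ε C q r₀ w ω j i s) :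
    ∃ s', Run K ν S ω ℓ sampleAndTry s s' (220 * n) ∧
      TrialInv K A t ε C q r₀ w ω j (i + 1) s' := by
  have hn := h.one_le
  set g : ℝ := (3 / 4) ^ j with hg
  have hg0 : 0 < g := by positivity
  have hg1 : g ≤ 1 := pow_le_one₀ (by norm_num) (by norm_num)
  set τ := trialWidth C q g with hτ
  have hτg : g / 4 ≤ τ := div_four_le_trialWidth C q g
  have hτ1 : τ ≤ 1 / 4 := trialWidth_le h.one_lt_C h.one_lt_q hg0 hg1
  set r := gauge K (w - ratVec t) with hr
  set x := ω (stageStart n C q j + i) with hx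
  set s₁ : State n := { s.setVec 2 x with pos := s.pos + 1 } with hs₁
  have hbr : ∃ s₂, Run K ν S ω ℓ (.ite (.const 0) (.norm (.vvar 2)) trial .skip) s₁ s₂
      (210 * n) ∧ s₂.pos = s₁.pos ∧ (∀ i ≠ 5, s₂.sc i = s₁.sc i) ∧ s₂.vec 0 = s₁.vec 0 ∧
      s₂.vec 1 ∈ lattice A ∧ s₂.sc 5 = gauge K (s₂.vec 1 - s₂.vec 0) ∧ s₂.sc 5 ≤ s₁.sc 5 ∧
      (0 < gauge K x → ∃ v, IsApproxClosest 2
        (slabBody K (scaledNormal ν (4 * τ / g) ((1 / gauge K x) • x))) A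
        (ratVec t + (s.sc 5 - 7 / 8 * (r₀ * g)) • ((1 / gauge K x) • x)) v ∧
        s₂.sc 5 ≤ gauge K (v - ratVec t)) := by
    have hx2 : s₁.vec 2 = x := by simp [hs₁, State.setVec]
    have h0 : s₁.vec 0 = s.vec 0 := by simp [hs₁, State.setVec]
    have h1 : s₁.vec 1 = s.vec 1 := by simp [hs₁, State.setVec]
    have hguard : ((Expr.const 0).eval K ν s₁ < (Expr.norm (.vvar 2)).eval K ν s₁) ↔
        0 < gauge K x := by
      simp [Expr.eval, hx2]
    -- The zero sample has no direction; the program skips it, so that all solver queries are sound.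
    by_cases hpos : 0 < gauge K x
    · set p := (1 / gauge K x) • x with hp
      have hp1 : gauge K p = 1 := by
        rw [hp, gauge_smul_eq_mul (by positivity), one_div_mul_cancel hpos.ne']
      set y := ratVec t + (s.sc 5 - 7 / 8 * (r₀ * g)) • p with hy
      have hnorm : ‖y‖ ≤ ‖ratVec t‖ + 2 * r₀ := by
        refine (norm_add_le _ _).trans (add_le_add_right ?_ _)
        rw [norm_smul, Real.norm_eq_abs]
        have hD0 : 0 ≤ s.sc 5 := hs.dist ▸ gauge_nonneg _
        have hrg : r₀ * g ≤ r₀ := mul_le_of_le_one_right h.nonneg hg1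
        have hrg0 : 0 ≤ r₀ * g := mul_nonneg h.nonneg hg0.le
        have : |s.sc 5 - 7 / 8 * (r₀ * g)| ≤ 2 * r₀ :=
          abs_le.2 ⟨by linarith, by linarith [hs.dist_le]⟩
        calc _ ≤ 2 * r₀ * 1 := mul_le_mul this (hp1 ▸ h.norm_le p) (norm_nonneg _)
              (by linarith [h.nonneg])
          _ = _ := mul_one _
      have hc1 : 1 ≤ 4 * τ / g := by rw [le_div_iff₀ hg0]; linarith
      have hc2 : 4 * τ / g ≤ 1 / ε := by
        rw [div_le_div_iff₀ hg0 h.eps_pos]; nlinarith [h.eps_pos]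
      obtain ⟨s₂, hrun, k1, k2, k3, k4, k5, k6, k7⟩ := run_trial (ν := ν) (S := S) (ω := ω) (ℓ := ℓ)
        (s := s₁) (p := p) (x := y) (u := scaledNormal ν (4 * τ / g) p) hn h.body
        (by rw [hx2]) (by rw [show s₁.sc = s.sc from rfl, hs.width, hs.gap])
        (by rw [show s₁.sc = s.sc from rfl, h0, hs.target, hs.radius, hs.gap])
        (h.size p _ y hp1 hc1 hc2 hnorm) (h1 ▸ hs.mem) (by rw [h0, h1]; exact hs.dist)
      refine ⟨s₂, (Run.ite_true (hguard.2 hpos) hrun).mono ?_, k1, k2, k3, k4, k5, k6, fun _ =>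
        ⟨_, S.correct _ (isSymmConvexBody_slabBody h.body _) y, ?_⟩⟩
      · simp only [Expr.cost]; omega
      · rw [h0, hs.target] at k7
        exact k7
    · refine ⟨s₁, (Run.ite_false (fun hh => hpos (hguard.1 hh)) (Run.skip _)).mono ?_, rfl,
        fun _ _ => rfl, rfl, h1 ▸ hs.mem, by rw [h0, h1]; exact hs.dist, le_rfl,
        fun hh => absurd hh hpos⟩
      simp only [Expr.cost]; omega
  obtain ⟨s₂, hrun, k1, k2, k3, k4, k5, k6, k7⟩ := hbr
  have h5 : s₂.sc 5 ≤ s.sc 5 := k6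
  have h0 : s₁.vec 0 = s.vec 0 := by simp [hs₁, State.setVec]
  have hsc : ∀ k ≠ 5, k ≠ 11 → (s₂.setSc 11 (i + 1)).sc k = s.sc k := fun k hk hk' =>
    (Function.update_of_ne hk' _ _).trans (k2 k hk)
  have hD : (s₂.setSc 11 (i + 1)).sc 5 = s₂.sc 5 := by simp [State.setSc]
  have hsample : Run K ν S ω ℓ (.sample 2) s s₁ (n + 1) := by
    have := Run.sample (K := K) (ν := ν) (S := S) (ω := ω) (ℓ := ℓ) s 2
    rwa [hs.pos, ← hx, ← hs.pos] at this
  refine ⟨s₂.setSc 11 (i + 1),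
    (hsample.seq (hrun.seq (Run.assign s₂ 11 _ (r := i + 1) ?_))).mono ?_, ?_⟩
  · simp [Expr.eval, k2, hs₁, State.setVec, hs.index]
  · simp only [Expr.cost]; omega
  · have hv0 : s₂.vec 0 = ratVec t := by rw [k3, h0, hs.target]
    have hgood : Lucky K C q (r⁻¹ • (w - ratVec t)) j ω → s.sc 5 ≤ r + r₀ * g := hs.good
    refine ⟨⟨?_, ?_, ?_, ?_, ?_, hv0, k4, k5, h5.trans hs.dist_le⟩, ?_, ?_, ?_, ?_, ?_, ?_,
      fun hl => h5.trans (hs.good hl), fun hl hit => ?_⟩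
    · rw [hsc _ (by norm_num) (by norm_num), hs.dim]
    · rw [hsc _ (by norm_num) (by norm_num), hs.eps]
    · rw [hsc _ (by norm_num) (by norm_num), hs.const]
    · rw [hsc _ (by norm_num) (by norm_num), hs.exponent]
    · rw [hsc _ (by norm_num) (by norm_num), hs.radius]
    · rw [hsc _ (by norm_num) (by norm_num), hs.gap]
    · rw [hsc _ (by norm_num) (by norm_num), hs.counter]
    · rw [hsc _ (by norm_num) (by norm_num), hs.width]
    · rw [hsc _ (by norm_num) (by norm_num), hs.count]
    · simp [State.setSc]
    · change s₂.pos = _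
      rw [k1, show s₁.pos = s.pos + 1 from rfl, hs.pos, add_assoc]
    · rw [hD]
      obtain ⟨k, hk, hkx⟩ := hit
      rcases (Nat.lt_succ_iff_lt_or_eq.1 hk) with hk | rfl
      · exact h5.trans (hs.hit hl ⟨k, hk, hkx⟩)
      by_contra! hlt
      have hr0 : 0 ≤ r₀ * g := mul_nonneg h.nonneg hg0.le
      have hrr : r₀ ≤ r := h.le_dist
      -- If `r₀ = 0`, then the current distance is `0` and cannot exceed anything.
      have hpos : 0 < r₀ := by
        refine h.nonneg.lt_of_ne fun h0 => ?_
        have := h5.trans hs.dist_le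
        rw [← h0] at this hlt hrr
        linarith
      have hrpos : 0 < r := hpos.trans_le hrr
      have hx0 : 0 < gauge K x := by
        refine (Seminorm.sub_normalize_le h.body.seminorm (e := r⁻¹ • (w - ratVec t)) ?_
          (τ := τ) (by linarith) hkx).1
        rw [h.body.seminorm_apply, gauge_smul_eq_mul (by positivity), inv_mul_cancel₀ hrpos.ne']
      obtain ⟨v, hv, hv5⟩ := k7 hx0
      have := gauge_answer_sub_le h.body h.support h.one_lt_C h.one_lt_q h.smooth h.mem hpos hg0 hg1
        hrr hs.dist_le (hgood hl) (by linarith) hkx hv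
      linarith [hgood hl]

theorem run_stage (h : Setting K ν A t ε C q r₀ w ℓ) (S : TwoCVPSolver A) {j : ℕ}
    (hj : ε < (3 / 4) ^ j) {s : State n} (hs : StageInv K A t ε C q r₀ w ω j s) :
    ∃ s', Run K ν S ω ℓ stage s s' (300 * n * (stageTrials n C q j + 1)) ∧
      StageInv K A t ε C q r₀ w ω (j + 1) s' := by
  have hn := h.one_le
  set τ := trialWidth C q ((3 / 4) ^ j) with hτ
  set N := trialCount n (n + 1 + j) τ with hN
  set s₁ := ((s.setSc 9 τ).setSc 10 N).setSc 11 0 with hs₁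
  have hinv : TrialInv K A t ε C q r₀ w ω j 0 s₁ := by
    refine ⟨⟨hs.dim, hs.eps, hs.const, hs.exponent, hs.radius, hs.target, hs.mem, hs.dist,
      hs.dist_le⟩, hs.gap, hs.counter, ?_, ?_, ?_, hs.pos, hs.good, ?_⟩
    · simp [hs₁, State.setSc, hτ]
    · simp [hs₁, State.setSc, hN, hτ]
    · simp [hs₁, State.setSc]
    · rintro - ⟨k, hk, -⟩
      omega
  obtain ⟨s₂, hloop, hs₂⟩ := Run.loop (K := K) (ν := ν) (S := S) (ω := ω) (ℓ := ℓ)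
    (a := .svar 11) (b := .svar 10) (p := sampleAndTry) (m := stageTrials n C q j)
    (I := TrialInv K A t ε C q r₀ w ω j) (c := fun _ => 220 * n)
    (fun i hi s hs => by
      simp only [Expr.eval]
      rw [hs.index, hs.count]
      exact Nat.lt_ceil.1 hi)
    (fun s hs => by
      simp only [Expr.eval]
      rw [hs.index, hs.count, not_lt]
      exact Nat.le_ceil _)
    (fun i _ s hs => run_sampleAndTry h S hj hs) hinv
  refine ⟨(s₂.setSc 7 ((3 / 4) ^ (j + 1))).setSc 8 (n + 1 + (j + 1 : ℕ)),
    ((Run.assign s 9 _ (r := τ) ?_).seq ((Run.assign _ 10 _ (r := N) ?_).seq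
      ((Run.assign _ 11 _ (r := 0) ?_).seq (hloop.seq ((Run.assign _ 7 _ ?_).seq
        (Run.assign _ 8 _ ?_)))))).mono ?_, ?_⟩
  · simp [widthExpr, Expr.eval, hs.gap, hs.const, hs.exponent, hτ, trialWidth]
  · simp [countExpr, Expr.eval, State.setSc, hs.counter, hs.dim, hN, trialCount]
  · simp [Expr.eval]
  · simp [Expr.eval, hs₂.gap, pow_succ']
  · simp [Expr.eval, State.setSc, hs₂.counter, add_assoc]
  · simp only [Expr.cost, widthExpr, countExpr, Finset.sum_const, Finset.card_range, smul_eq_mul]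
    nlinarith [Nat.zero_le (stageTrials n C q j), Nat.mul_le_mul_right (stageTrials n C q j) hn]
  · refine ⟨⟨hs₂.dim, hs₂.eps, hs₂.const, hs₂.exponent, hs₂.radius, hs₂.target, hs₂.mem, hs₂.dist,
      hs₂.dist_le⟩, ?_, ?_, ?_, fun hl => ?_⟩
    · simp [State.setSc]
    · simp [State.setSc]
    · exact hs₂.pos.trans (Finset.sum_range_succ _ _).symm
    · have := hs₂.hit (lucky_succ.1 hl).1 (lucky_succ.1 hl).2
      change s₂.sc 5 ≤ _
      rw [pow_succ]
      linarith

/-- The run of the whole program. Whenever it is lucky, its output is as good as `w` up to the factor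
`1 + ε`. -/
theorem run_boost {v₀ : E n} (S : TwoCVPSolver A)
    (hv₀ : v₀ = S.answer (slabBody K 0) (ratVec t))
    (h : Setting K ν A t ε C q (1 / 2 * gauge K (v₀ - ratVec t)) w ℓ)
    (hsize : InstanceSizeLE A (slabBody K 0) (ratVec t) ℓ) {m : ℕ}
    (hm : ∀ j < m, ε < (3 / 4) ^ j) (hm' : (3 / 4) ^ m ≤ ε) :
    ∃ s, Run K ν S ω ℓ boost (initState ε C q t) s
        (400 * n * (1 + ∑ j ∈ Finset.range m, (stageTrials n C q j + 1))) ∧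
      s.output ∈ lattice A ∧
      (Lucky K C q ((gauge K (w - ratVec t))⁻¹ • (w - ratVec t)) m ω →
        gauge K (s.output - ratVec t) ≤ (1 + ε) * gauge K (w - ratVec t)) := by
  subst hv₀
  have hn := h.one_le
  set v₀ := S.answer (slabBody K 0) (ratVec t) with hv₀
  set D := gauge K (v₀ - ratVec t) with hD
  set s₁ : State n := (((((initState ε C q t).setVec 1 v₀).setSc 5 D).setSc 4 (1 / 2 * D)).setSc 7
    1).setSc 8 (n + 1) with hs₁
  have hinv : StageInv K A t ε C q (1 / 2 * D) w ω 0 s₁ := by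
    refine ⟨⟨?_, ?_, ?_, ?_, ?_, ?_, ?_, ?_, ?_⟩, ?_, ?_, ?_, fun _ => ?_⟩
    all_goals try simp [hs₁, State.setSc, State.setVec, initState, hD, stageStart]
    · exact (S.correct _ (isSymmConvexBody_slabBody h.body 0) _).1
    · have := h.le_dist
      linarith
  obtain ⟨s₂, hloop, hs₂⟩ := Run.loop (K := K) (ν := ν) (S := S) (ω := ω) (ℓ := ℓ)
    (a := .svar 1) (b := .svar 7) (p := stage) (m := m)
    (I := StageInv K A t ε C q (1 / 2 * D) w ω)
    (c := fun j => 300 * n * (stageTrials n C q j + 1))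
    (fun j hj s hs => by
      simp only [Expr.eval]
      rw [hs.eps, hs.gap]
      exact hm j hj)
    (fun s hs => by
      simp only [Expr.eval]
      rw [hs.eps, hs.gap, not_lt]
      exact hm')
    (fun j hj s hs => run_stage h S (hm j hj) hs) hinv
  refine ⟨s₂, ((Run.solve _ 1 _ 6 _ (bodyOf_norm _) (x := ratVec t) ?_
    (isSymmConvexBody_slabBody h.body 0) hsize).seq ((Run.assign _ 5 _ (r := D) ?_).seq
      ((Run.assign _ 4 _ (r := 1 / 2 * D) ?_).seq ((Run.assign _ 7 _ (r := 1) ?_).seq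
        ((Run.assign _ 8 _ (r := n + 1) ?_).seq hloop))))).mono ?_, hs₂.mem, fun hl => ?_⟩
  · simp [Expr.eval, initState]
  · rw [eval_distExpr]; simp [State.setVec, initState, hD, hv₀]
  · simp [Expr.eval, State.setSc]
  · simp [Expr.eval]
  · simp [Expr.eval, State.setSc, State.setVec, initState]
  · simp only [Expr.cost, distExpr]
    have : ∑ j ∈ Finset.range m, (1 + 1 + 1 + 300 * n * (stageTrials n C q j + 1)) ≤
        ∑ j ∈ Finset.range m, 400 * n * (stageTrials n C q j + 1) :=
      Finset.sum_le_sum fun j _ => by nlinarith [Nat.zero_le (stageTrials n C q j)]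
    rw [← Finset.mul_sum] at this
    nlinarith
  · have h1 := hs₂.good hl
    have h2 : 1 / 2 * D * (3 / 4) ^ m ≤ gauge K (w - ratVec t) * ε :=
      mul_le_mul h.le_dist hm' (by positivity) (gauge_nonneg _)
    have h3 := hs₂.dist
    rw [hs₂.target] at h3
    change gauge K (s₂.vec 1 - ratVec t) ≤ _
    linarith

end Correctness

/-! ### Sizes of the queries -/

section Sizes

variable {n : ℕ} {K : Set (E n)} {ν : E n → E n} {A : Matrix (Fin n) (Fin n) ℚ} {t : Fin n → ℚ}
  {ε : ℝ}

/-- The bound `200 * (n + b + ⌈log (1/ε)⌉)` for the size of all queries. The factor is dictated by the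
number of memory cells in `cells_boost_le`, which has to obey the same constant. -/
noncomputable def querySize (A : Matrix (Fin n) (Fin n) ℚ) (t : Fin n → ℚ) (ε : ℝ) : ℕ :=
  200 * (n + encLength A t + ⌈Real.log (1 / ε)⌉₊)

theorem inv_radius_le (hn : 1 ≤ n) : ((n : ℝ) ^ (-(3 / 2) : ℝ))⁻¹ ≤ 2 ^ (2 * n) := by
  have h1 : (1 : ℝ) ≤ n := by exact_mod_cast hn
  rw [Real.rpow_neg (by positivity), inv_inv]
  calc (n : ℝ) ^ (3 / 2 : ℝ) ≤ (n : ℝ) ^ (2 : ℝ) :=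
        Real.rpow_le_rpow_of_exponent_le h1 (by norm_num)
    _ = (n : ℝ) ^ 2 := Real.rpow_two _
    _ ≤ ((2 : ℝ) ^ n) ^ 2 :=
      pow_le_pow_left₀ (by positivity) (by exact_mod_cast Nat.lt_two_pow_self.le) 2
    _ = 2 ^ (2 * n) := by rw [← pow_mul, mul_comm]

theorem one_div_le_two_pow (hε : 0 < ε) : 1 / ε ≤ 2 ^ (2 * ⌈Real.log (1 / ε)⌉₊) := by
  have h : Real.exp 1 ≤ 2 ^ 2 := by linarith [Real.exp_one_lt_d9]
  calc 1 / ε = Real.exp (Real.log (1 / ε)) := (Real.exp_log (by positivity)).symm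
    _ ≤ Real.exp (⌈Real.log (1 / ε)⌉₊ * 1) := by
      rw [mul_one]; exact Real.exp_le_exp.2 (Nat.le_ceil _)
    _ = Real.exp 1 ^ ⌈Real.log (1 / ε)⌉₊ := Real.exp_nat_mul _ _
    _ ≤ _ := by rw [pow_mul]; exact pow_le_pow_left₀ (Real.exp_pos _).le h _

theorem instanceSizeLE_slabBody (hn : 1 ≤ n)
    (hball : Metric.closedBall 0 ((n : ℝ) ^ (-(3 / 2) : ℝ)) ⊆ K) (hK : IsSymmConvexBody K)
    (hsub : K ⊆ Metric.closedBall 0 1) (hε : 0 < ε) {u x : E n} {c : ℝ} (hc : 1 ≤ c)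
    (hcε : c ≤ 1 / ε) (hu : ∀ y, |inner ℝ u y| ≤ c * gauge K y)
    (hx : ‖x‖ ≤ 2 ^ (3 * n + encLength A t + 2)) :
    InstanceSizeLE A (slabBody K u) x (querySize A t ε) := by
  have hr : 0 < (n : ℝ) ^ (-(3 / 2) : ℝ) := Real.rpow_pos_of_pos (by exact_mod_cast hn) _
  have h2 : (1 : ℝ) ≤ 2 ^ querySize A t ε := one_le_pow₀ (by norm_num)
  refine ⟨?_, ?_, ?_, hx.trans (pow_le_pow_right₀ (by norm_num) ?_)⟩
  · unfold querySize encLength; omega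
  · refine (Metric.closedBall_subset_closedBall ?_).trans
      (closedBall_subset_slabBody hr hc hball hu)
    rw [inv_le_comm₀ (by positivity) (by positivity), inv_div, div_eq_mul_inv]
    calc c * ((n : ℝ) ^ (-(3 / 2) : ℝ))⁻¹
        ≤ 2 ^ (2 * ⌈Real.log (1 / ε)⌉₊) * 2 ^ (2 * n) :=
          mul_le_mul (hcε.trans (one_div_le_two_pow hε)) (inv_radius_le hn) (by positivity)
            (by positivity)
      _ ≤ 2 ^ querySize A t ε := by
        rw [← pow_add]
        exact pow_le_pow_right₀ (by norm_num) (by unfold querySize; omega)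
  · exact fun y hy => Metric.closedBall_subset_closedBall h2 (hsub (hK.gauge_le_one_iff.1 hy.1))
  · unfold querySize; omega

theorem slabBody_zero (hK : IsSymmConvexBody K) : slabBody K 0 = K := by
  ext y
  simp [slabBody, hK.gauge_le_one_iff]

end Sizes

/-! ### The number of stages and the running time -/

theorem exists_stage_number {ε : ℝ} (hε : 0 < ε) (hε1 : ε < 1) :
    ∃ m : ℕ, (∀ j < m, ε < (3 / 4 : ℝ) ^ j) ∧ (3 / 4 : ℝ) ^ m ≤ ε ∧
      (m : ℝ) ≤ 1 + 4 * Real.log (1 / ε) := by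
  classical
  have hex : ∃ m : ℕ, (3 / 4 : ℝ) ^ m ≤ ε :=
    (exists_pow_lt_of_lt_one hε (by norm_num)).imp fun _ h => h.le
  refine ⟨Nat.find hex, fun j hj => not_le.1 (Nat.find_min hex hj), Nat.find_spec hex, ?_⟩
  rcases hm : Nat.find hex with _ | k
  · have : 0 < Real.log (1 / ε) := Real.log_pos (by rw [lt_div_iff₀ hε]; linarith)
    push_cast
    linarith
  · have hk : ε < (3 / 4 : ℝ) ^ k := not_le.1 (Nat.find_min hex (by omega))
    have h1 := Real.log_lt_log hε hk
    rw [Real.log_pow] at h1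
    have h2 : Real.log (3 / 4 : ℝ) ≤ 3 / 4 - 1 := Real.log_le_sub_one_of_pos (by norm_num)
    have h3 : (k : ℝ) * Real.log (3 / 4) ≤ k * (3 / 4 - 1) :=
      mul_le_mul_of_nonneg_left h2 (Nat.cast_nonneg k)
    rw [one_div, Real.log_inv]
    push_cast
    linarith

/-- The arithmetic of the running time: the number of trials is at most
`poly * 2 ^ (12 n) * (C/ε) ^ (n/q)`, and each of them costs at most `2 ^ (κ n) * poly`. -/
theorem cost_le {n b m T κ : ℕ} {C q ε : ℝ} (hn : 1 ≤ n) (hC : 1 < C) (hq : 1 < q) (hε : 0 < ε)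
    (hε1 : ε < 1) (hm : ∀ j < m, ε < (3 / 4 : ℝ) ^ j) (hm4 : (m : ℝ) ≤ 1 + 4 * Real.log (1 / ε))
    (hT : T ≤ 400 * n * (1 + ∑ j ∈ Finset.range m, (stageTrials n C q j + 1)) *
      (2 ^ (κ * n) * (n + 200 * (n + b + ⌈Real.log (1 / ε)⌉₊)) ^ κ + 1)) :
    (T : ℝ) ≤ 36800 * 401 ^ κ * (n + b + Real.log (1 / ε)) ^ (3 + κ) *
      (2 ^ ((κ + 12) * n) * (C ^ ((n : ℝ) / q) * (1 / ε) ^ ((n : ℝ) / q))) := by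
  set L := Real.log (1 / ε) with hL
  have hL0 : 0 < L := Real.log_pos (by rw [lt_div_iff₀ hε]; linarith)
  set Z : ℝ := n + b + L with hZ
  have hn' : (1 : ℝ) ≤ n := by exact_mod_cast hn
  have hb' : (0 : ℝ) ≤ b := Nat.cast_nonneg b
  have hZn : (n : ℝ) ≤ Z := by linarith
  have hZ1 : 1 ≤ Z := hn'.trans hZn
  have hmZ : (m : ℝ) ≤ 5 * Z := by linarith
  set F := C ^ ((n : ℝ) / q) * (1 / ε) ^ ((n : ℝ) / q) with hF
  have hF1 : 1 ≤ F := one_le_mul_of_one_le_of_one_le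
    (Real.one_le_rpow hC.le (by positivity))
    (Real.one_le_rpow (by rw [le_div_iff₀ hε]; linarith) (by positivity))
  set G := 2 ^ (12 * n) * F with hG
  have hG1 : 1 ≤ G := one_le_mul_of_one_le_of_one_le (one_le_pow₀ (by norm_num)) hF1
  have htrial : ∀ j ∈ Finset.range m, ((stageTrials n C q j + 1 : ℕ) : ℝ) ≤ 9 * Z * G := by
    intro j hj
    have hj := Finset.mem_range.1 hj
    have h1 := stageTrials_le n hC hq hε (hm j hj).le
    rw [mul_assoc (2 ^ (12 * n) : ℝ), ← hF, ← hG] at h1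
    have h2 : (j : ℝ) ≤ m := by exact_mod_cast hj.le
    push_cast
    nlinarith
  have hsum : ((∑ j ∈ Finset.range m, (stageTrials n C q j + 1) : ℕ) : ℝ) ≤ 45 * Z ^ 2 * G := by
    push_cast
    have := Finset.sum_le_card_nsmul _ _ _ htrial
    rw [Finset.card_range, nsmul_eq_mul] at this
    push_cast at this
    refine this.trans ?_
    calc (m : ℝ) * (9 * Z * G) ≤ 5 * Z * (9 * Z * G) :=
          mul_le_mul_of_nonneg_right hmZ (by positivity)
      _ = _ := by ring
  have hc : (400 * n * (1 + (∑ j ∈ Finset.range m, (stageTrials n C q j + 1) : ℕ)) : ℝ) ≤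
      400 * Z * (46 * Z ^ 2 * G) := by
    have : 1 ≤ Z ^ 2 * G := one_le_mul_of_one_le_of_one_le (one_le_pow₀ hZ1) hG1
    exact mul_le_mul (by linarith) (by linarith) (by positivity) (by positivity)
  have hW : ((2 ^ (κ * n) * (n + 200 * (n + b + ⌈L⌉₊)) ^ κ + 1 : ℕ) : ℝ) ≤
      2 * (2 ^ (κ * n) * (401 * Z) ^ κ) := by
    have h1 : (n + 200 * (n + b + ⌈L⌉₊) : ℝ) ≤ 401 * Z := by
      have := Nat.ceil_lt_add_one hL0.le
      linarith
    have h2 : ((2 : ℝ) ^ (κ * n) * (n + 200 * (n + b + ⌈L⌉₊) : ℝ) ^ κ) ≤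
        2 ^ (κ * n) * (401 * Z) ^ κ :=
      mul_le_mul_of_nonneg_left (pow_le_pow_left₀ (by positivity) h1 κ) (by positivity)
    have h3 : (1 : ℝ) ≤ 2 ^ (κ * n) * (401 * Z) ^ κ :=
      one_le_mul_of_one_le_of_one_le (one_le_pow₀ (by norm_num)) (one_le_pow₀ (by linarith))
    push_cast
    linarith
  have hT' : (T : ℝ) ≤ _ := Nat.cast_le.2 hT
  rw [Nat.cast_mul] at hT'
  refine hT'.trans ((mul_le_mul (le_trans (le_of_eq (by push_cast; ring)) hc) hW (by positivity)
    (by positivity)).trans (le_of_eq ?_))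
  rw [hG, mul_pow, add_mul, pow_add, pow_add]
  ring

end BoostCVP

theorem mainTheorem3 :
    ∃ (prog : Prog) (a : ℕ), ∀ κ : ℕ, ∃ B : ℕ,
      ∀ (n : ℕ) (_ : 1 ≤ n) (K : Set (E n)) (_ : IsSymmConvexBody K)
        (_ : Metric.closedBall 0 ((n : ℝ) ^ (-(3 / 2) : ℝ)) ⊆ K) (_ : K ⊆ Metric.closedBall 0 1)
        (C q : ℝ) (_ : 1 < C) (_ : 1 < q)
        (_ : ∀ τ : ℝ, 0 < τ → τ < 1 → modulusOfSmoothness K τ ≤ C * τ ^ q)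
        (ε : ℝ) (_ : 0 < ε) (_ : ε < 1)
        (A : Matrix (Fin n) (Fin n) ℚ) (t : Fin n → ℚ)
        (ν : E n → E n) (_ : IsSupportOracle K ν) (S : TwoCVPSolver A),
        -- every run halts, within the claimed space and time
        (∀ ω : ℕ → E n, (∀ k, ω k ∈ K) →
          ∃ (s : State n) (T M : ℕ), Exec K ν S ω prog (initState ε C q t) s T M ∧
            (∀ σ : ℕ,
              (∀ (Q : Set (E n)) (x : E n), IsSymmConvexBody Q →
                InstanceSizeLE A Q x (a * (n + encLength A t + ⌈Real.log (1 / ε)⌉₊)) →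
                S.space Q x ≤ σ) →
              prog.cells n + M ≤ σ + a * n) ∧
            (S.RunsIn κ →
              (T : ℝ) ≤ B * (n + encLength A t + Real.log (1 / ε)) ^ B *
                ((2 : ℝ) ^ (B * n) * C ^ ((n : ℝ) / q) * (1 / ε) ^ ((n : ℝ) / q) +
                  (B * C) ^ ((n : ℝ) / (q - 1))))) ∧
        -- on independent uniform samples from `K` the output is correct with high probability
        (∀ {Ω : Type*} [MeasurableSpace Ω] (P : Measure Ω) [IsProbabilityMeasure P]
          (X : ℕ → Ω → E n), (∀ k, Measurable (X k)) → iIndepFun X P →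
          (∀ k, P.map (X k) = ProbabilityTheory.cond volume K) →
          P {o | ¬ ∃ (s : State n) (T M : ℕ),
              Exec K ν S (fun k => X k o) prog (initState ε C q t) s T M ∧
              IsApproxClosest (1 + ε) K A (ratVec t) s.output} ≤
            ENNReal.ofReal ((2 : ℝ) ^ (-(n : ℝ))))
      := by
  refine ⟨boost, 200, fun κ => ⟨36800 * 401 ^ κ + κ + 12, ?_⟩⟩
  intro n hn K hK hball hsub C q hC hq hsmooth ε hε hε1 A t ν hν S
  have hsm := hK.hasPowerSmoothness hsmooth
  have hr : 0 < (n : ℝ) ^ (-(3 / 2) : ℝ) := Real.rpow_pos_of_pos (by exact_mod_cast hn) _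
  obtain ⟨w, hw, hmin⟩ := exists_closest hK hsub A (ratVec t)
  obtain ⟨m, hm, hm', hm4⟩ := exists_stage_number hε hε1
  set v₀ := S.answer (slabBody K 0) (ratVec t) with hv₀
  have hv₀c : IsApproxClosest 2 K A (ratVec t) v₀ := by
    have := S.correct K hK (ratVec t)
    rwa [hv₀, slabBody_zero hK]
  have hD : gauge K (v₀ - ratVec t) ≤ 2 ^ (3 * n + encLength A t + 1) := by
    have h1 := hv₀c.2 0 (zero_mem_lattice A)
    rw [zero_sub, gauge_neg hK.neg_mem] at h1
    have h2 := gauge_le_norm_div hr hball (ratVec t)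
    rw [div_eq_mul_inv] at h2
    have h3 := mul_le_mul (norm_ratVec_le A t) (inv_radius_le hn) (by positivity) (by positivity)
    calc gauge K (v₀ - ratVec t) ≤ 2 * (2 ^ (n + encLength A t) * 2 ^ (2 * n)) := by linarith
      _ = _ := by rw [← pow_add, ← pow_succ']; congr 1; ring
  have hbound : ‖ratVec t‖ + gauge K (v₀ - ratVec t) ≤ 2 ^ (3 * n + encLength A t + 2) := by
    have : (2 : ℝ) ^ (n + encLength A t) ≤ 2 ^ (3 * n + encLength A t + 1) :=
      pow_le_pow_right₀ (by norm_num) (by omega)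
    rw [pow_succ _ (3 * n + encLength A t + 1)]
    linarith [norm_ratVec_le A t]
  have hset : Setting K ν A t ε C q (1 / 2 * gauge K (v₀ - ratVec t)) w (querySize A t ε) := by
    refine ⟨hn, hK, hν, hC, hq, hsm, hε, hw, mul_nonneg (by norm_num) (gauge_nonneg _), ?_, ?_,
      fun p => hK.norm_le_gauge hsub p⟩
    · linarith [hv₀c.2 w hw]
    · intro p c x hp hc hc' hx
      exact instanceSizeLE_slabBody hn hball hK hsub hε hc hc'
        (abs_inner_scaledNormal_le hK hν hp (by linarith)) (hx.trans (by linarith))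
  have hsize : InstanceSizeLE A (slabBody K 0) (ratVec t) (querySize A t ε) :=
    instanceSizeLE_slabBody hn hball hK hsub hε le_rfl
      (by rw [le_div_iff₀ hε]; linarith)
      (fun y => by simpa using gauge_nonneg y) (by linarith [gauge_nonneg (s := K) (v₀ - ratVec t)])
  have hrun := fun ω => run_boost (ω := ω) S hv₀ hset hsize hm hm'
  refine ⟨fun ω _ => ?_, ?_⟩
  · obtain ⟨s, ⟨T, M, hexec, hM, hT⟩, -, -⟩ := hrun ω
    refine ⟨s, T, M, hexec, fun σ hσ => ?_, fun hS => ?_⟩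
    · have h1 := hM σ hσ
      have h2 := cells_boost_le hn
      omega
    · refine (cost_le (κ := κ) hn hC hq hε hε1 hm hm4
        (hT _ fun Q x hQ hQx => hS _ Q x hQ hQx)).trans ?_
      set B := 36800 * 401 ^ κ + κ + 12 with hB
      have hL0 : 0 < Real.log (1 / ε) := Real.log_pos (by rw [lt_div_iff₀ hε]; linarith)
      have hn' : (1 : ℝ) ≤ n := by exact_mod_cast hn
      have hZ1 : 1 ≤ (n : ℝ) + encLength A t + Real.log (1 / ε) := by
        linarith [Nat.cast_nonneg (α := ℝ) (encLength A t)]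
      have hpow : 1 ≤ 401 ^ κ := Nat.one_le_pow _ _ (by norm_num)
      rw [mul_assoc ((2 : ℝ) ^ (B * n))]
      refine mul_le_mul (mul_le_mul ?_ (pow_le_pow_right₀ hZ1 (by omega)) (by positivity)
        (by positivity)) ?_ (by positivity) (by positivity)
      · exact_mod_cast (by omega : 36800 * 401 ^ κ ≤ B)
      · refine le_add_of_le_of_nonneg (mul_le_mul_of_nonneg_right (pow_le_pow_right₀ (by norm_num)
          (Nat.mul_le_mul_right n (by omega))) (by positivity)) (by positivity)
  · intro Ω _ P _ X hX hind hlaw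
    set e := (gauge K (w - ratVec t))⁻¹ • (w - ratVec t) with he
    have he1 : gauge K e ≤ 1 := by
      rw [he, gauge_smul_eq_mul (inv_nonneg.2 (gauge_nonneg _))]
      exact inv_mul_le_one
    refine (measure_mono fun o ho => ?_).trans (measure_not_lucky_le hK hC hq hX hind hlaw he1 m)
    intro hl
    obtain ⟨s, ⟨T, M, hexec, -, -⟩, hmem, happrox⟩ := hrun fun k => X k o
    refine ho ⟨s, T, M, hexec, hmem, fun v hv => (happrox hl).trans ?_⟩
    exact mul_le_mul_of_nonneg_left (hmin v hv) (by linarith)
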